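/- Let $m\ge 2$ be an integer, and let $\mu_1,\dots,\mu_m$ be Borel probability measures on $\mathbb{C}$ with $\int_{\mathbb{C}}\log_+|w|\,d\mu_k(w)<\infty$ for each $k$, where $\log_+x=\max\{\log x,0\}$. Write $U_{\mu}(z)=\int_{\mathbb{C}}\log|z-w|\,d\mu(w)\in[-\infty,\infty)$ for the logarithmic potential of $\mu$. Let $\{X_{i,k}: i\ge 1,\ 1\le k\le m\}$ be independent complex random variables on a common probability space such that $X_{i,k}$ has distribution $\mu_k$. For each $k$ let $n_k=n_k(n)$, $n\ge 1$, be a sequence of non-negative integers with $n_1=n$ and $n_k\le n$ for all $k$ and all $n$, such that the limits $c_k=\lim_{n\to\infty}n_k/n\in[0,1]$ exist. Assume that $\mu_k$ is non-degenerate (not a point mass) for every $k$ for which the sequence $(n_k)_{n\ge1}$ is unbounded. Put $$p_{n,k}(z)=\prod_{i=1}^{n_k}(z-X_{i,k}),\qquad \rho_n=\frac1n\sum_{i=1}^n\delta_{z_i^{(n)}},$$ where $z_1^{(n)},\dots,z_n^{(n)}$ are the zeros, with multiplicity, of the degree-$n$ polynomial $\sum_{k=1}^m p_{n,k}$. Let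 $U(z)=\max_{1\le k\le m}c_kU_{\mu_k}(z)$, where $c_kU_{\mu_k}$ is understood to be $0$ everywhere if $c_k=0$. Then $U$ is finite Lebesgue-almost everywhere and locally integrable, and there is a deterministic probability measure $\rho$ on $\mathbb{C}$ such that $\rho_n$ converges weakly to $\rho$ in probability as $n\to\infty$; that is, for every bounded continuous $\varphi:\mathbb{C}\to\mathbb{C}$, $\int\varphi\,d\rho_n\to\int\varphi\,d\rho$ in probability. Moreover $\rho$ is the unique probability measure on $\mathbb{C}$ with $$\int_{\mathbb{C}}\varphi\,d\rho=\frac1{2\pi}\int_{\mathbb{C}}\Delta\varphi(z)\,U(z)\,d\lambda(z)\qquad\text{for all smooth compactly supported }\varphi:\mathbb{C}\to\mathbb{C},$$ where $\lambda$ is Lebesgue measure; in particular $\rho$ depends only on $\mu_1,\dots,\mu_m$ and $c_1,\dots,c_m$. -/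

import Mathlib

open MeasureTheory ProbabilityTheory Filter Topology Polynomial
open scoped ENNReal BoundedContinuousFunction Laplacian

noncomputable section

namespace RandomPolySum

/-- The measure integrates `log₊ |w|`. -/
def HasLogMoment (μ : Measure ℂ) : Prop :=
  Integrable (fun w : ℂ => Real.posLog ‖w‖) μ

/-- The measure is not a point mass. -/
def NonDegenerate (μ : Measure ℂ) : Prop :=
  ∀ a : ℂ, μ ≠ Measure.dirac a

/-- The logarithmic potential `U_μ(z) = ∫ log |z - w| dμ(w)` with values in `[-∞, ∞]`, i.e. the
integral of the positive part minus the integral of the negative part of `w ↦ log |z - w|`.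
Here `ENNReal.log 0 = -∞`, so that an atom of `μ` at `z` gives the value `-∞`. -/
def logPotential (μ : Measure ℂ) (z : ℂ) : EReal :=
  ((∫⁻ w, (ENNReal.log ‖z - w‖ₑ).toENNReal ∂μ : ℝ≥0∞) : EReal) -
    ((∫⁻ w, (-ENNReal.log ‖z - w‖ₑ).toENNReal ∂μ : ℝ≥0∞) : EReal)

/-- The function `c U_μ`, which is `0` everywhere if `c = 0`. -/
def scaledPotential (c : ℝ) (μ : Measure ℂ) (z : ℂ) : EReal :=
  if c = 0 then 0 else (c : EReal) * logPotential μ z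

/-- The function `U = max_k c_k U_{μ_k}`. -/
def maxPotential {m : ℕ} (c : Fin m → ℝ) (μ : Fin m → Measure ℂ) (z : ℂ) : EReal :=
  ⨆ k, scaledPotential (c k) (μ k) z

open scoped ContDiff in
/-- `ρ = (1/2π) Δ U` in the sense of distributions. -/
def IsDistribLaplacian (ρ : Measure ℂ) (U : ℂ → EReal) : Prop :=
  ∀ φ : ℂ → ℂ, ContDiff ℝ ∞ φ → HasCompactSupport φ →
    ∫ z, φ z ∂ρ = (2 * Real.pi)⁻¹ • ∫ z, (U z).toReal • (Δ φ) z ∂volume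

/-- The monic polynomial with roots `x 0, …, x (d - 1)`. -/
def rootPoly (x : ℕ → ℂ) (d : ℕ) : ℂ[X] :=
  ∏ i ∈ Finset.range d, (X - C (x i))

/-- The measure `(1/n) ∑ δ_z` over the zeros `z` of `p`, counted with multiplicity. -/
def empiricalRootMeasure (n : ℕ) (p : ℂ[X]) : Measure ℂ :=
  (n : ℝ≥0∞)⁻¹ • (p.roots.map (fun z => Measure.dirac z)).sum

/-- Weak convergence in probability of random measures on `ℂ` to a deterministic measure. -/
def TendstoWeaklyInProbability {Ω : Type*} [MeasurableSpace Ω] (P : Measure Ω)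
    (ρn : ℕ → Ω → Measure ℂ) (ρ : Measure ℂ) : Prop :=
  ∀ φ : ℂ →ᵇ ℂ,
    TendstoInMeasure P (fun n ω => ∫ z, φ z ∂(ρn n ω)) atTop (fun _ => ∫ z, φ z ∂ρ)

end RandomPolySum

end

/-!
If `p` has degree `n` and leading coefficient `a`, then `n⁻¹ log |p|` is the logarithmic potential
of the empirical measure of its zeros plus `n⁻¹ log |a|`. As `(2π)⁻¹ log |z|` is a fundamental
solution of the Laplace equation on the plane, that measure is `(2π)⁻¹ Δ (n⁻¹ log |p|)`, so it
suffices to show that `n⁻¹ log |∑ p_{n,k}|` converges to `max_k c_k U_{μ_k}` in probability against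
compactly supported functions.

For almost every fixed `z` the weak law of large numbers gives the size of each single factor
`p_{n,k}(z)`. A cancellation between the summands is excluded by anticoncentration: the logarithm of
the modulus of the largest summand fluctuates, so, the others being fixed, the sum is unlikely to be
exponentially smaller than it.

Convergence at almost every `z` passes to integrals because the `L²` norms of `n⁻¹ log |∑ p_{n,k}|`
on balls are controlled by the logarithmic moments of the zeros, which are tight by Jensen's
formula. The same tightness upgrades convergence against test functions to weak convergence.
-/

noncomputable section

namespace RandomPolySum

open Real Metric

section Green

variable {E F : Type*} [NormedAddCommGroup E] [NormedAddCommGroup F] [NormedSpace ℝ F]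

theorem iteratedFDeriv_two_apply_self [NormedSpace ℝ E] {f : E → F} (hf : ContDiff ℝ 2 f)
    (x v : E) :
    iteratedFDeriv ℝ 2 f x ![v, v] = fderiv ℝ (fun y => fderiv ℝ f y v) x v := by
  have hf' : DifferentiableAt ℝ (fderiv ℝ f) x :=
    (hf.fderiv_right (m := 1) (by norm_num)).differentiable one_ne_zero x
  rw [iteratedFDeriv_two_apply, fderiv_clm_apply hf' (differentiableAt_const v)]
  simp

theorem contDiff_fderiv_apply_const [NormedSpace ℝ E] {f : E → F} {m n : WithTop ℕ∞}
    (hf : ContDiff ℝ n f) (hmn : m + 1 ≤ n) (v : E) : ContDiff ℝ m fun x => fderiv ℝ f x v :=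
  (hf.fderiv_right hmn).clm_apply contDiff_const

theorem continuous_fderiv_fderiv_apply_const [NormedSpace ℝ E] {f : E → F} (hf : ContDiff ℝ 2 f)
    (v : E) : Continuous fun x => fderiv ℝ (fun y => fderiv ℝ f y v) x v :=
  (contDiff_fderiv_apply_const (m := 0) (contDiff_fderiv_apply_const (m := 1) hf
    (by norm_num) v) (by norm_num) v).continuous

theorem integrable_smul_of_hasCompactSupport {X : Type*} [TopologicalSpace X] [MeasurableSpace X]
    [OpensMeasurableSpace X] {μ : Measure X} [IsFiniteMeasureOnCompacts μ] {g : X → ℝ} {φ : X → F}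
    (hg : Continuous g) (hφ : Continuous φ) (hc : HasCompactSupport φ) :
    Integrable (fun x => g x • φ x) μ :=
  (hg.smul hφ).integrable_of_hasCompactSupport hc.smul_left

variable [InnerProductSpace ℝ E] [FiniteDimensional ℝ E]

theorem laplacian_eq_sum_fderiv {ι : Type*} [Fintype ι] (b : OrthonormalBasis ι ℝ E) {f : E → F}
    (hf : ContDiff ℝ 2 f) : Δ f = fun x => ∑ i, fderiv ℝ (fun y => fderiv ℝ f y (b i)) x (b i) := by
  rw [InnerProductSpace.laplacian_eq_iteratedFDeriv_orthonormalBasis f b]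
  exact funext fun x => Finset.sum_congr rfl fun i _ => iteratedFDeriv_two_apply_self hf x (b i)

theorem continuous_laplacian {f : E → F} (hf : ContDiff ℝ 2 f) : Continuous (Δ f) := by
  rw [laplacian_eq_sum_fderiv (stdOrthonormalBasis ℝ E) hf]
  exact continuous_finsetSum _ fun i _ => continuous_fderiv_fderiv_apply_const hf _

theorem hasCompactSupport_laplacian {f : E → F} (hf : HasCompactSupport f) :
    HasCompactSupport (Δ f) := by
  rw [InnerProductSpace.laplacian_eq_iteratedFDeriv_stdOrthonormalBasis]
  refine (hf.iteratedFDeriv (𝕜 := ℝ) 2).mono' fun x hx => subset_tsupport _ fun h => hx ?_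
  simp [h]

theorem laplacian_comp_add_right (f : E → F) (a : E) :
    Δ (fun x => f (x + a)) = fun x => (Δ f) (x + a) := by
  simp only [InnerProductSpace.laplacian_eq_iteratedFDeriv_stdOrthonormalBasis,
    iteratedFDeriv_comp_add_right]

variable [MeasurableSpace E] [BorelSpace E] {μ : Measure E} [μ.IsAddHaarMeasure]

theorem integral_smul_fderiv_eq_neg {g : E → ℝ} (hg : ContDiff ℝ 1 g) {φ : E → F}
    (hφ : ContDiff ℝ 1 φ) (hc : HasCompactSupport φ) (v : E) :
    ∫ x, g x • fderiv ℝ φ x v ∂μ = -∫ x, fderiv ℝ g x v • φ x ∂μ := by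
  have hg' := (contDiff_fderiv_apply_const (m := 0) hg (by norm_num) v).continuous
  have hφ' := (contDiff_fderiv_apply_const (m := 0) hφ (by norm_num) v).continuous
  exact integral_smul_fderiv_eq_neg_fderiv_smul_of_integrable
    (integrable_smul_of_hasCompactSupport hg' hφ.continuous hc)
    (integrable_smul_of_hasCompactSupport hg.continuous hφ' (hc.fderiv_apply ℝ v))
    (integrable_smul_of_hasCompactSupport hg.continuous hφ.continuous hc)
    (fun x _ => hg.differentiable one_ne_zero x) (fun x _ => hφ.differentiable one_ne_zero x)

theorem integral_smul_fderiv_fderiv {g : E → ℝ} (hg : ContDiff ℝ 2 g) {φ : E → F}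
    (hφ : ContDiff ℝ 2 φ) (hc : HasCompactSupport φ) (v : E) :
    ∫ x, g x • fderiv ℝ (fun y => fderiv ℝ φ y v) x v ∂μ =
      ∫ x, fderiv ℝ (fun y => fderiv ℝ g y v) x v • φ x ∂μ := by
  rw [integral_smul_fderiv_eq_neg (hg.of_le one_le_two)
      (contDiff_fderiv_apply_const hφ (by norm_num) v) (hc.fderiv_apply ℝ v),
    integral_smul_fderiv_eq_neg (contDiff_fderiv_apply_const hg (by norm_num) v)
      (hφ.of_le one_le_two) hc, neg_neg]

theorem integral_smul_laplacian {g : E → ℝ} (hg : ContDiff ℝ 2 g) {φ : E → F}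
    (hφ : ContDiff ℝ 2 φ) (hc : HasCompactSupport φ) :
    ∫ x, g x • (Δ φ) x ∂μ = ∫ x, (Δ g) x • φ x ∂μ := by
  simp_rw [laplacian_eq_sum_fderiv (stdOrthonormalBasis ℝ E) hφ,
    laplacian_eq_sum_fderiv (stdOrthonormalBasis ℝ E) hg, Finset.smul_sum, Finset.sum_smul]
  rw [integral_finsetSum, integral_finsetSum]
  · exact Finset.sum_congr rfl fun i _ => integral_smul_fderiv_fderiv hg hφ hc _
  · exact fun i _ => integrable_smul_of_hasCompactSupport
      (continuous_fderiv_fderiv_apply_const hg _) hφ.continuous hc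
  · exact fun i _ => integrable_smul_of_hasCompactSupport hg.continuous
      (continuous_fderiv_fderiv_apply_const hφ _) ((hc.fderiv_apply ℝ _).fderiv_apply ℝ _)

theorem integral_laplacian_eq_zero {φ : E → F} (hφ : ContDiff ℝ 2 φ) (hc : HasCompactSupport φ) :
    ∫ x, (Δ φ) x ∂μ = 0 := by
  simpa using integral_smul_laplacian (μ := μ) (g := fun _ => (1 : ℝ)) contDiff_const hφ hc

end Green

section FundamentalSolution

theorem abs_log_eq_posLog_add_posLog_inv (x : ℝ) : |log x| = log⁺ x + log⁺ x⁻¹ := by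
  linarith [half_mul_log_add_log_abs (x := x), posLog_sub_posLog_inv (x := x)]

theorem mul_posLog_inv_sq_le {r : ℝ} (hr : 0 < r) : r * log⁺ r⁻¹ ^ 2 ≤ 4 := by
  have hs : 0 < √r := sqrt_pos.2 hr
  have h : √r * log⁺ r⁻¹ ≤ 2 := by
    have hpow : log⁺ r⁻¹ = 2 * log⁺ (√r)⁻¹ := by
      rw [← sq_sqrt hr.le, ← inv_pow, posLog_pow, sq_sqrt hr.le, Nat.cast_ofNat]
    have hle : log⁺ (√r)⁻¹ ≤ (√r)⁻¹ :=
      max_le (inv_pos.2 hs).le (log_le_self (inv_pos.2 hs).le)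
    calc √r * log⁺ r⁻¹ ≤ √r * (2 * (√r)⁻¹) := by rw [hpow]; gcongr
      _ = 2 := by field_simp
  calc r * log⁺ r⁻¹ ^ 2 = (√r * log⁺ r⁻¹) ^ 2 := by rw [mul_pow, sq_sqrt hr.le]
    _ ≤ 2 ^ 2 := by gcongr; exact mul_nonneg hs.le posLog_nonneg
    _ = 4 := by norm_num

theorem measurable_posLog_inv_norm : Measurable fun z : ℂ => log⁺ ‖z‖⁻¹ :=
  continuous_posLog.measurable.comp measurable_norm.inv

theorem memLp_two_posLog_inv_norm : MemLp (fun z : ℂ => log⁺ ‖z‖⁻¹) 2 := by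
  rw [memLp_two_iff_integrable_sq measurable_posLog_inv_norm.aestronglyMeasurable,
    integrable_fun_norm_addHaar volume (f := fun r : ℝ => log⁺ r⁻¹ ^ 2),
    Complex.finrank_real_complex]
  have hdom : Integrable ((Set.Ioc (0 : ℝ) 1).indicator fun _ => (4 : ℝ)) :=
    (integrable_indicator_iff measurableSet_Ioc).2 (by simp)
  refine hdom.integrableOn.mono' (by fun_prop) ?_
  filter_upwards [ae_restrict_mem measurableSet_Ioi] with r (hr : 0 < r)
  have hnorm : ‖r ^ (2 - 1) • log⁺ r⁻¹ ^ 2‖ = r * log⁺ r⁻¹ ^ 2 := by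
    simp [abs_of_pos hr]
  rw [hnorm]
  by_cases h1 : r ≤ 1
  · rw [Set.indicator_of_mem (Set.mem_Ioc.2 ⟨hr, h1⟩)]
    exact mul_posLog_inv_sq_le hr
  · have hzero : log⁺ r⁻¹ = 0 := by
      rw [posLog_eq_zero_iff, abs_inv, abs_of_pos hr]
      exact inv_le_one_of_one_le₀ (not_le.1 h1).le
    rw [Set.indicator_of_notMem fun h => h1 h.2, hzero]
    norm_num

theorem locallyIntegrable_log_norm : LocallyIntegrable fun z : ℂ => log ‖z‖ := by
  have hpos : LocallyIntegrable fun z : ℂ => log⁺ ‖z‖ :=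
    (continuous_posLog.comp continuous_norm).locallyIntegrable
  have hneg : LocallyIntegrable fun z : ℂ => log⁺ ‖z‖⁻¹ :=
    memLp_two_posLog_inv_norm.locallyIntegrable one_le_two
  simp_rw [← posLog_sub_posLog_inv]
  exact hpos.sub hneg

/-- The smooth approximation `log √(|z|² + ε²)` of the logarithmic kernel `log |z|`. -/
def regLog (ε : ℝ) (z : ℂ) : ℝ := 2⁻¹ * log (‖z‖ ^ 2 + ε ^ 2)

theorem regLog_zero (z : ℂ) : regLog 0 z = log ‖z‖ := by
  simp [regLog, log_pow]

theorem hasFDerivAt_norm_sq_add (a : ℝ) (z : ℂ) :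
    HasFDerivAt (fun z : ℂ => ‖z‖ ^ 2 + a) (2 • innerSL ℝ z) z :=
  (hasStrictFDerivAt_norm_sq z).hasFDerivAt.add_const a

variable {ε : ℝ}

theorem norm_sq_add_sq_pos (hε : 0 < ε) (z : ℂ) : 0 < ‖z‖ ^ 2 + ε ^ 2 := by positivity

theorem contDiff_regLog (hε : 0 < ε) : ContDiff ℝ 2 (regLog ε) :=
  contDiff_const.mul
    (((contDiff_norm_sq ℝ).add contDiff_const).log fun z => (norm_sq_add_sq_pos hε z).ne')

theorem fderiv_regLog (hε : 0 < ε) (z v : ℂ) :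
    fderiv ℝ (regLog ε) z v = inner ℝ z v / (‖z‖ ^ 2 + ε ^ 2) := by
  have h : HasFDerivAt (regLog ε) _ z :=
    ((hasFDerivAt_norm_sq_add (ε ^ 2) z).log (norm_sq_add_sq_pos hε z).ne').const_mul 2⁻¹
  rw [h.fderiv]
  simp only [smul_apply, innerSL_apply_apply, smul_eq_mul, nsmul_eq_mul, Nat.cast_ofNat]
  ring

theorem fderiv_fderiv_regLog (hε : 0 < ε) (z v : ℂ) :
    fderiv ℝ (fun y => fderiv ℝ (regLog ε) y v) z v =
      ‖v‖ ^ 2 / (‖z‖ ^ 2 + ε ^ 2) - 2 * inner ℝ z v ^ 2 / (‖z‖ ^ 2 + ε ^ 2) ^ 2 := by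
  have hne := (norm_sq_add_sq_pos hε z).ne'
  have hinner : HasFDerivAt (fun z : ℂ => inner ℝ z v) _ z :=
    (hasFDerivAt_id z).inner ℝ (hasFDerivAt_const v z)
  have h : HasFDerivAt (fun y : ℂ => inner ℝ y v * (‖y‖ ^ 2 + ε ^ 2)⁻¹) _ z :=
    hinner.mul ((hasDerivAt_inv hne).comp_hasFDerivAt z (hasFDerivAt_norm_sq_add (ε ^ 2) z))
  simp_rw [fderiv_regLog hε, div_eq_mul_inv]
  rw [h.fderiv]
  simp only [add_apply, smul_apply, neg_smul, neg_apply, innerSL_apply_apply,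
    ContinuousLinearMap.comp_apply, ContinuousLinearMap.prod_apply, ContinuousLinearMap.id_apply,
    zero_apply, fderivInnerCLM_apply, inner_zero_right, real_inner_self_eq_norm_sq, zero_add,
    id_eq, smul_eq_mul, nsmul_eq_mul, Nat.cast_ofNat]
  field_simp
  ring

theorem laplacian_regLog (hε : 0 < ε) (z : ℂ) :
    (Δ (regLog ε)) z = 2 * ε ^ 2 / (‖z‖ ^ 2 + ε ^ 2) ^ 2 := by
  have hne := (norm_sq_add_sq_pos hε z).ne'
  have hnorm : inner ℝ z 1 ^ 2 + inner ℝ z Complex.I ^ 2 = ‖z‖ ^ 2 := by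
    rw [← Complex.normSq_eq_norm_sq, Complex.normSq_apply]
    simp only [Complex.inner, Complex.mul_re, Complex.conj_re, Complex.conj_im, Complex.one_re,
      Complex.one_im, Complex.I_re, Complex.I_im]
    ring
  rw [laplacian_eq_sum_fderiv Complex.orthonormalBasisOneI (contDiff_regLog hε)]
  simp only [Fin.sum_univ_two, Complex.coe_orthonormalBasisOneI, Matrix.cons_val_zero,
    Matrix.cons_val_one, fderiv_fderiv_regLog hε, norm_one, Complex.norm_I]
  rw [show inner ℝ z Complex.I ^ 2 = ‖z‖ ^ 2 - inner ℝ z 1 ^ 2 by linarith]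
  field_simp
  ring

theorem integral_inv_pi_div_norm_sq_add_one_sq :
    ∫ z : ℂ, π⁻¹ / (‖z‖ ^ 2 + 1) ^ 2 = 1 := by
  have hderiv : ∀ r ∈ Set.Ioi (0 : ℝ), HasDerivAt (fun r : ℝ => -(2 * π)⁻¹ * (r ^ 2 + 1)⁻¹)
      (r ^ (2 - 1) • (π⁻¹ / (r ^ 2 + 1) ^ 2)) r := by
    intro r _
    have hne : r ^ 2 + 1 ≠ 0 := by positivity
    refine ((((hasDerivAt_pow 2 r).add_const 1).inv hne).const_mul _).congr_deriv ?_
    simp only [Nat.add_one_sub_one, pow_one, Nat.cast_ofNat, smul_eq_mul]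
    field_simp
  have hcont : Continuous fun r : ℝ => -(2 * π)⁻¹ * (r ^ 2 + 1)⁻¹ :=
    continuous_const.mul (Continuous.inv₀ (by fun_prop) fun r => by positivity)
  have hlim : Tendsto (fun r : ℝ => -(2 * π)⁻¹ * (r ^ 2 + 1)⁻¹) atTop (𝓝 (-(2 * π)⁻¹ * 0)) :=
    (tendsto_inv_atTop_zero.comp (tendsto_atTop_add_const_right _ _
      (tendsto_pow_atTop two_ne_zero))).const_mul _
  have hnonneg : ∀ r ∈ Set.Ioi (0 : ℝ), 0 ≤ r ^ (2 - 1) • (π⁻¹ / (r ^ 2 + 1) ^ 2) := by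
    intro r (hr : 0 < r)
    rw [smul_eq_mul]
    positivity
  rw [integral_fun_norm_addHaar volume (fun r : ℝ => π⁻¹ / (r ^ 2 + 1) ^ 2),
    Complex.finrank_real_complex,
    integral_Ioi_of_hasDerivAt_of_nonneg hcont.continuousWithinAt hderiv hnonneg hlim]
  simp [Measure.real, Complex.volume_ball]

theorem tendsto_norm_sq_mul_div_cobounded :
    Tendsto (fun z : ℂ => ‖z‖ ^ 2 * (π⁻¹ / (‖z‖ ^ 2 + 1) ^ 2)) (Bornology.cobounded ℂ) (𝓝 0) := by
  have hlim : Tendsto (fun z : ℂ => π⁻¹ * (‖z‖ ^ 2 + 1)⁻¹) (Bornology.cobounded ℂ)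
      (𝓝 (π⁻¹ * 0)) :=
    (tendsto_inv_atTop_zero.comp (tendsto_atTop_add_const_right _ _
      ((tendsto_pow_atTop two_ne_zero).comp tendsto_norm_cobounded_atTop))).const_mul _
  rw [mul_zero] at hlim
  refine squeeze_zero (fun z => by positivity) (fun z => ?_) hlim
  rw [div_eq_mul_inv, mul_left_comm, sq (‖z‖ ^ 2 + 1), mul_inv, ← mul_assoc (‖z‖ ^ 2)]
  gcongr
  refine mul_le_of_le_one_left (by positivity) ?_
  rw [← div_eq_mul_inv, div_le_one (by positivity)]
  linarith

variable {F : Type*} [NormedAddCommGroup F] [NormedSpace ℝ F]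

-- `Δ (regLog c⁻¹)` is `2π` times the rescaling by `c` of the probability density
-- `π⁻¹ (|z|² + 1)⁻²`, so it is an approximate identity as `c → ∞`.
theorem tendsto_integral_laplacian_regLog [CompleteSpace F] {φ : ℂ → F} (hφ : Continuous φ)
    (hc : HasCompactSupport φ) :
    Tendsto (fun c : ℝ => ∫ z, (Δ (regLog c⁻¹)) z • φ z) atTop (𝓝 ((2 * π) • φ 0)) := by
  have hkernel := tendsto_integral_comp_smul_smul_of_integrable
    (μ := (volume : Measure ℂ)) (φ := fun z : ℂ => π⁻¹ / (‖z‖ ^ 2 + 1) ^ 2)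
    (fun z => by positivity) integral_inv_pi_div_norm_sq_add_one_sq
    (by simpa only [Complex.finrank_real_complex] using tendsto_norm_sq_mul_div_cobounded)
    (hφ.integrable_of_hasCompactSupport hc) hφ.continuousAt
  refine (hkernel.const_smul (2 * π)).congr' ?_
  filter_upwards [eventually_gt_atTop 0] with c hc0
  rw [← integral_smul]
  refine integral_congr_ae (ae_of_all _ fun z => ?_)
  simp only [smul_smul, laplacian_regLog (inv_pos.2 hc0), Complex.finrank_real_complex, norm_smul,
    norm_of_nonneg hc0.le]
  congr 1
  field_simp

theorem abs_regLog_le (hε : 0 < ε) (hε1 : ε ≤ 1) {z : ℂ} (hz : z ≠ 0) :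
    |regLog ε z| ≤ |regLog 1 z| + |log ‖z‖| := by
  have : 0 < ‖z‖ := norm_pos_iff.2 hz
  have hlower : log ‖z‖ ≤ regLog ε z := by
    rw [← regLog_zero, regLog, regLog]
    gcongr
  have hupper : regLog ε z ≤ regLog 1 z := by
    rw [regLog, regLog]
    gcongr
  rw [abs_le]
  constructor
  · linarith [neg_abs_le (log ‖z‖), abs_nonneg (regLog 1 z)]
  · linarith [le_abs_self (regLog 1 z), abs_nonneg (log ‖z‖)]

theorem tendsto_integral_regLog_smul {ψ : ℂ → F} (hψ : Continuous ψ) (hc : HasCompactSupport ψ) :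
    Tendsto (fun ε => ∫ z, regLog ε z • ψ z) (𝓝[>] 0) (𝓝 (∫ z, log ‖z‖ • ψ z)) := by
  have hne : ∀ᵐ z : ℂ, z ≠ 0 := by simp [ae_iff]
  have hint1 : Integrable fun z => ‖regLog 1 z • ψ z‖ :=
    (integrable_smul_of_hasCompactSupport (contDiff_regLog one_pos).continuous hψ hc).norm
  have hint2 : Integrable fun z => ‖log ‖z‖ • ψ z‖ :=
    (locallyIntegrable_log_norm.integrable_smul_right_of_hasCompactSupport hψ hc).norm
  have hsmall : ∀ᶠ ε : ℝ in 𝓝[>] 0, ε ∈ Set.Ioc 0 1 := Ioc_mem_nhdsGT one_pos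
  refine tendsto_integral_filter_of_dominated_convergence _ ?_ ?_ (hint1.add hint2) ?_
  · filter_upwards [hsmall] with ε hε
    exact ((contDiff_regLog hε.1).continuous.smul hψ).aestronglyMeasurable
  · filter_upwards [hsmall] with ε hε
    filter_upwards [hne] with z hz
    simp only [Pi.add_apply, norm_smul, norm_eq_abs, ← add_mul]
    gcongr
    exact abs_regLog_le hε.1 hε.2 hz
  · filter_upwards [hne] with z hz
    refine Tendsto.smul_const ?_ _
    have hcont : ContinuousAt (fun ε => regLog ε z) 0 :=
      continuousAt_const.mul (ContinuousAt.log (by fun_prop) (by simpa using hz))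
    rw [← regLog_zero]
    exact hcont.tendsto.mono_left nhdsWithin_le_nhds

theorem integral_log_norm_smul_laplacian [CompleteSpace F] {φ : ℂ → F} (hφ : ContDiff ℝ 2 φ)
    (hc : HasCompactSupport φ) : ∫ z, log ‖z‖ • (Δ φ) z = (2 * π) • φ 0 := by
  have hleft := (tendsto_integral_regLog_smul (continuous_laplacian hφ)
    (hasCompactSupport_laplacian hc)).comp tendsto_inv_atTop_nhdsGT_zero
  refine tendsto_nhds_unique (hleft.congr' ?_) (tendsto_integral_laplacian_regLog hφ.continuous hc)
  filter_upwards [eventually_gt_atTop 0] with c hc0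
  exact integral_smul_laplacian (contDiff_regLog (inv_pos.2 hc0)) hφ hc

theorem integral_log_norm_sub_smul_laplacian [CompleteSpace F] {φ : ℂ → F} (hφ : ContDiff ℝ 2 φ)
    (hc : HasCompactSupport φ) (w : ℂ) : ∫ z, log ‖z - w‖ • (Δ φ) z = (2 * π) • φ w := by
  have h := integral_log_norm_smul_laplacian (φ := fun z => φ (z + w))
    (hφ.comp (contDiff_id.add contDiff_const)) (hc.comp_homeomorph (Homeomorph.addRight w))
  rw [laplacian_comp_add_right, zero_add] at h
  rw [← h, ← integral_add_right_eq_self _ w]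
  simp only [add_sub_cancel_right]

end FundamentalSolution

section Potential

theorem eLpNorm_two_sq_eq_lintegral {α ε : Type*} [MeasurableSpace α] [ENorm ε] (f : α → ε)
    (μ : Measure α) : eLpNorm f 2 μ ^ 2 = ∫⁻ x, ‖f x‖ₑ ^ 2 ∂μ := by
  simpa using eLpNorm_nnreal_pow_eq_lintegral (f := f) (μ := μ) two_ne_zero

theorem lintegral_sq_le_lintegral_sq {α : Type*} [MeasurableSpace α] {ν : Measure α}
    [IsProbabilityMeasure ν] {f : α → ℝ≥0∞} (hf : AEMeasurable f ν) :
    (∫⁻ x, f x ∂ν) ^ 2 ≤ ∫⁻ x, f x ^ 2 ∂ν := by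
  have h := pow_le_pow_left' (eLpNorm_le_eLpNorm_of_exponent_le (one_le_two (α := ℝ≥0∞))
    hf.aestronglyMeasurable) 2
  simpa only [eLpNorm_one_eq_lintegral_enorm, eLpNorm_two_sq_eq_lintegral, enorm_eq_self] using h

theorem eLpNorm_two_lintegral_sub_le {G : Type*} [AddGroup G] [MeasurableSpace G]
    [MeasurableAdd G] [MeasurableSub₂ G] {μ ν : Measure G} [SFinite μ] [μ.IsAddRightInvariant]
    [IsProbabilityMeasure ν] {f : G → ℝ≥0∞} (hf : Measurable f) :
    eLpNorm (fun z => ∫⁻ w, f (z - w) ∂ν) 2 μ ≤ eLpNorm f 2 μ := by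
  rw [← ENNReal.pow_le_pow_left_iff two_ne_zero, eLpNorm_two_sq_eq_lintegral,
    eLpNorm_two_sq_eq_lintegral]
  simp only [enorm_eq_self]
  calc ∫⁻ z, (∫⁻ w, f (z - w) ∂ν) ^ 2 ∂μ
      ≤ ∫⁻ z, ∫⁻ w, f (z - w) ^ 2 ∂ν ∂μ :=
        lintegral_mono fun z => lintegral_sq_le_lintegral_sq
          (hf.comp (measurable_const.sub measurable_id)).aemeasurable
    _ = ∫⁻ w, ∫⁻ z, f (z - w) ^ 2 ∂μ ∂ν :=
        lintegral_lintegral_swap ((hf.comp measurable_sub).pow_const 2).aemeasurable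
    _ = ∫⁻ z, f z ^ 2 ∂μ := by
        simp [lintegral_sub_right_eq_self fun z => f z ^ 2]

/-- The logarithmic moment `∫ log₊ |w| dν(w)`, which is finite exactly if `HasLogMoment ν`. -/
def logMoment (ν : Measure ℂ) : ℝ≥0∞ := ∫⁻ w, ‖log⁺ ‖w‖‖ₑ ∂ν

/-- The logarithmic potential as a Bochner integral. It agrees with `logPotential ν` at the points
where the logarithmic kernel is integrable and which are not atoms of `ν`. -/
def realPotential (ν : Measure ℂ) (z : ℂ) : ℝ := ∫ w, log ‖z - w‖ ∂ν

/-- The potential `∫ |log |z - w|| dν(w)` of the absolute value of the logarithmic kernel. -/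
def absPotential (ν : Measure ℂ) (z : ℂ) : ℝ≥0∞ := ∫⁻ w, ‖log ‖z - w‖‖ₑ ∂ν

theorem measurable_log_norm_sub : Measurable fun p : ℂ × ℂ => log ‖p.1 - p.2‖ := by fun_prop

theorem measurable_realPotential (ν : Measure ℂ) [SFinite ν] : Measurable (realPotential ν) :=
  (measurable_log_norm_sub.stronglyMeasurable.integral_prod_right' (ν := ν)).measurable

theorem measurable_absPotential (ν : Measure ℂ) [SFinite ν] : Measurable (absPotential ν) :=
  measurable_log_norm_sub.enorm.lintegral_prod_right'

theorem enorm_realPotential_le (ν : Measure ℂ) (z : ℂ) :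
    ‖realPotential ν z‖ₑ ≤ absPotential ν z :=
  enorm_integral_le_lintegral_enorm _

theorem abs_log_norm_sub_le (z w : ℂ) :
    |log ‖z - w‖| ≤ log⁺ ‖z - w‖⁻¹ + (log 2 + log⁺ ‖z‖ + log⁺ ‖w‖) := by
  have h := posLog_norm_add_le z (-w)
  rw [← sub_eq_add_neg, norm_neg] at h
  rw [abs_log_eq_posLog_add_posLog_inv]
  linarith

theorem enorm_log_norm_sub_le {z : ℂ} {R : ℝ} (hz : z ∈ closedBall 0 R) (w : ℂ) :
    ‖log ‖z - w‖‖ₑ ≤ ‖log⁺ ‖z - w‖⁻¹‖ₑ + (‖log 2 + log⁺ R‖ₑ + ‖log⁺ ‖w‖‖ₑ) := by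
  have hlog2 : 0 ≤ log 2 := log_nonneg one_le_two
  have hR : log⁺ ‖z‖ ≤ log⁺ R := posLog_le_posLog (norm_nonneg z) (mem_closedBall_zero_iff.1 hz)
  rw [enorm_of_nonneg posLog_nonneg, enorm_of_nonneg posLog_nonneg,
    enorm_of_nonneg (add_nonneg hlog2 posLog_nonneg), enorm_eq_ofReal_abs,
    ← ENNReal.ofReal_add (add_nonneg hlog2 posLog_nonneg) posLog_nonneg,
    ← ENNReal.ofReal_add posLog_nonneg
      (add_nonneg (add_nonneg hlog2 posLog_nonneg) posLog_nonneg)]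
  refine ENNReal.ofReal_le_ofReal ((abs_log_norm_sub_le z w).trans ?_)
  gcongr

theorem absPotential_le {ν : Measure ℂ} [IsProbabilityMeasure ν] {z : ℂ} {R : ℝ}
    (hz : z ∈ closedBall 0 R) :
    absPotential ν z ≤ ∫⁻ w, ‖log⁺ ‖z - w‖⁻¹‖ₑ ∂ν + (‖log 2 + log⁺ R‖ₑ + logMoment ν) := by
  refine (lintegral_mono fun w => enorm_log_norm_sub_le hz w).trans_eq ?_
  have hmeas : Measurable fun w => ‖log⁺ ‖z - w‖⁻¹‖ₑ :=
    (measurable_posLog_inv_norm.comp (measurable_const.sub measurable_id)).enorm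
  rw [lintegral_add_left hmeas, lintegral_add_left measurable_const]
  simp [logMoment]

theorem exists_eLpNorm_absPotential_le (R : ℝ) : ∃ A : ℝ≥0∞, A ≠ ∞ ∧
    ∀ (ν : Measure ℂ) [IsProbabilityMeasure ν],
      eLpNorm (absPotential ν) 2 (volume.restrict (closedBall 0 R)) ≤ A * (1 + logMoment ν) := by
  set B := closedBall (0 : ℂ) R
  set L := eLpNorm (fun z : ℂ => ‖log⁺ ‖z‖⁻¹‖ₑ) 2 volume
  set V := volume B ^ (2⁻¹ : ℝ)
  have hL : L ≠ ∞ := by simpa [L] using memLp_two_posLog_inv_norm.eLpNorm_ne_top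
  have hV : V ≠ ∞ := ENNReal.rpow_ne_top_of_nonneg (by norm_num) measure_closedBall_lt_top.ne
  refine ⟨L + ‖log 2 + log⁺ R‖ₑ * V + V, by finiteness, fun ν _ => ?_⟩
  have hmeas : Measurable fun z => ∫⁻ w, ‖log⁺ ‖z - w‖⁻¹‖ₑ ∂ν :=
    (measurable_posLog_inv_norm.comp measurable_sub).enorm.lintegral_prod_right'
  have hyoung : eLpNorm (fun z => ∫⁻ w, ‖log⁺ ‖z - w‖⁻¹‖ₑ ∂ν) 2 volume ≤ L :=
    eLpNorm_two_lintegral_sub_le (f := fun z : ℂ => ‖log⁺ ‖z‖⁻¹‖ₑ)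
      measurable_posLog_inv_norm.enorm
  calc eLpNorm (absPotential ν) 2 (volume.restrict B)
      ≤ eLpNorm ((fun z => ∫⁻ w, ‖log⁺ ‖z - w‖⁻¹‖ₑ ∂ν) +
          fun _ => ‖log 2 + log⁺ R‖ₑ + logMoment ν) 2 (volume.restrict B) :=
        eLpNorm_mono_enorm_ae ((ae_restrict_mem measurableSet_closedBall).mono fun z hz =>
          absPotential_le hz)
    _ ≤ eLpNorm (fun z => ∫⁻ w, ‖log⁺ ‖z - w‖⁻¹‖ₑ ∂ν) 2 (volume.restrict B) +
          eLpNorm (fun _ => ‖log 2 + log⁺ R‖ₑ + logMoment ν) 2 (volume.restrict B) :=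
        eLpNorm_add_le hmeas.aestronglyMeasurable aestronglyMeasurable_const one_le_two
    _ ≤ L + (‖log 2 + log⁺ R‖ₑ + logMoment ν) * V := by
        gcongr
        · exact (eLpNorm_mono_measure _ Measure.restrict_le_self).trans hyoung
        · refine (eLpNorm_const' _ two_ne_zero ENNReal.ofNat_ne_top).trans_le ?_
          simp [V]
    _ ≤ (L + ‖log 2 + log⁺ R‖ₑ * V + V) * (1 + logMoment ν) := by
        rw [mul_add, mul_one, add_mul _ _ V, ← add_assoc, mul_comm (logMoment ν)]
        exact add_le_add le_self_add (mul_le_mul_left le_add_self _)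

theorem HasLogMoment.logMoment_lt_top {ν : Measure ℂ} (hν : HasLogMoment ν) : logMoment ν < ∞ :=
  hν.hasFiniteIntegral

section HasLogMoment

variable {ν : Measure ℂ} [IsProbabilityMeasure ν]

theorem HasLogMoment.memLp_absPotential (hν : HasLogMoment ν) (R : ℝ) :
    MemLp (absPotential ν) 2 (volume.restrict (closedBall 0 R)) := by
  obtain ⟨A, hA, hle⟩ := exists_eLpNorm_absPotential_le R
  exact ⟨(measurable_absPotential ν).aestronglyMeasurable, (hle ν).trans_lt
    (ENNReal.mul_lt_top hA.lt_top (ENNReal.add_lt_top.2 ⟨by simp, hν.logMoment_lt_top⟩))⟩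

theorem HasLogMoment.memLp_realPotential (hν : HasLogMoment ν) (R : ℝ) :
    MemLp (realPotential ν) 2 (volume.restrict (closedBall 0 R)) :=
  ⟨(measurable_realPotential ν).aestronglyMeasurable,
    (eLpNorm_mono_enorm (enorm_realPotential_le ν)).trans_lt (hν.memLp_absPotential R).2⟩

theorem HasLogMoment.lintegral_absPotential_lt_top (hν : HasLogMoment ν) (R : ℝ) :
    ∫⁻ z in closedBall 0 R, absPotential ν z < ∞ := by
  have : IsFiniteMeasure (volume.restrict (closedBall (0 : ℂ) R)) :=
    isFiniteMeasure_restrict.2 measure_closedBall_lt_top.ne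
  simpa [eLpNorm_one_eq_lintegral_enorm] using
    ((hν.memLp_absPotential R).mono_exponent one_le_two).2

/-- The points `z` where `logPotential ν z` is finite; points where the logarithmic kernel takes
its junk value `log 0 = 0` with positive probability are excluded. -/
structure IsRegularPoint (ν : Measure ℂ) (z : ℂ) : Prop where
  integrable_log : Integrable (fun w => log ‖z - w‖) ν
  ae_ne : ∀ᵐ w ∂ν, w ≠ z

theorem HasLogMoment.ae_isRegularPoint (hν : HasLogMoment ν) : ∀ᵐ z, IsRegularPoint ν z := by
  have hfin : ∀ᵐ z, absPotential ν z < ∞ := by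
    rw [← Measure.restrict_univ (μ := volume), ← iUnion_closedBall_nat (0 : ℂ),
      ae_restrict_iUnion_iff]
    exact fun n => ae_lt_top (measurable_absPotential ν) (hν.lintegral_absPotential_lt_top n).ne
  have hne : ∀ᵐ z : ℂ, ∀ᵐ w ∂ν, w ≠ z := by
    rw [Measure.ae_ae_comm (measurableSet_eq_fun measurable_snd measurable_fst).compl]
    exact ae_of_all _ fun w => by simp [ae_iff]
  filter_upwards [hfin, hne] with z hz hzne
  exact ⟨⟨(measurable_log_norm_sub.comp measurable_prodMk_left).aestronglyMeasurable, hz⟩, hzne⟩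

theorem HasLogMoment.integrable_log_norm_sub_smul (hν : HasLogMoment ν) {F : Type*}
    [NormedAddCommGroup F] [NormedSpace ℝ F] {ψ : ℂ → F} (hψ : Continuous ψ)
    (hc : HasCompactSupport ψ) :
    Integrable (fun p : ℂ × ℂ => log ‖p.1 - p.2‖ • ψ p.1) (volume.prod ν) := by
  obtain ⟨C, hC⟩ := hc.exists_bound_of_continuous hψ
  obtain ⟨R, hR⟩ := hc.isCompact.isBounded.subset_closedBall (0 : ℂ)
  have hmeas : AEStronglyMeasurable (fun p : ℂ × ℂ => log ‖p.1 - p.2‖ • ψ p.1) (volume.prod ν) :=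
    measurable_log_norm_sub.aestronglyMeasurable.smul
      (hψ.comp_aestronglyMeasurable measurable_fst.aestronglyMeasurable)
  refine ⟨hmeas, ?_⟩
  rw [hasFiniteIntegral_iff_enorm, lintegral_prod _ hmeas.enorm]
  have hsupp : (fun z => absPotential ν z * ‖ψ z‖ₑ).support ⊆ closedBall 0 R := fun z hz =>
    hR (subset_tsupport ψ fun hψz => hz (by simp [hψz]))
  calc ∫⁻ z, ∫⁻ w, ‖log ‖z - w‖ • ψ z‖ₑ ∂ν
      = ∫⁻ z, absPotential ν z * ‖ψ z‖ₑ := by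
        simp only [enorm_smul, lintegral_mul_const' _ _ enorm_ne_top, absPotential]
    _ = ∫⁻ z in closedBall 0 R, absPotential ν z * ‖ψ z‖ₑ :=
        (setLIntegral_eq_of_support_subset hsupp).symm
    _ ≤ ∫⁻ z in closedBall 0 R, absPotential ν z * ENNReal.ofReal C := by
        gcongr with z
        rw [← ofReal_norm]
        exact ENNReal.ofReal_le_ofReal (hC z)
    _ < ∞ := by
        rw [lintegral_mul_const _ (measurable_absPotential ν)]
        exact ENNReal.mul_lt_top (hν.lintegral_absPotential_lt_top R) ENNReal.ofReal_lt_top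

theorem HasLogMoment.integral_eq_integral_realPotential_smul_laplacian (hν : HasLogMoment ν)
    {F : Type*} [NormedAddCommGroup F] [NormedSpace ℝ F] [CompleteSpace F] {φ : ℂ → F}
    (hφ : ContDiff ℝ 2 φ) (hc : HasCompactSupport φ) :
    ∫ w, φ w ∂ν = (2 * π)⁻¹ • ∫ z, realPotential ν z • (Δ φ) z := by
  have hint := hν.integrable_log_norm_sub_smul (continuous_laplacian hφ)
    (hasCompactSupport_laplacian hc)
  have hfubini : ∫ z, realPotential ν z • (Δ φ) z = (2 * π) • ∫ w, φ w ∂ν :=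
    calc ∫ z, realPotential ν z • (Δ φ) z
        = ∫ z, ∫ w, log ‖z - w‖ • (Δ φ) z ∂ν := by simp only [integral_smul_const, realPotential]
      _ = ∫ w, ∫ z, log ‖z - w‖ • (Δ φ) z ∂volume ∂ν := integral_integral_swap hint
      _ = (2 * π) • ∫ w, φ w ∂ν := by
        simp only [integral_log_norm_sub_smul_laplacian hφ hc, integral_smul]
  rw [hfubini, inv_smul_smul₀ two_pi_pos.ne']

end HasLogMoment

theorem toENNReal_coe_eq_ofReal (x : ℝ) : (x : EReal).toENNReal = ENNReal.ofReal x := by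
  rw [EReal.toENNReal_of_ne_top (EReal.coe_ne_top x), EReal.toReal_coe]

theorem IsRegularPoint.logPotential_eq {ν : Measure ℂ} {z : ℂ} (hz : IsRegularPoint ν z) :
    logPotential ν z = realPotential ν z := by
  have hlog : ∀ᵐ w ∂ν, ENNReal.log ‖z - w‖ₑ = (log ‖z - w‖ : EReal) := by
    filter_upwards [hz.ae_ne] with w hw
    rw [← ofReal_norm, ENNReal.log_ofReal_of_pos (norm_pos_iff.2 (sub_ne_zero.2 hw.symm))]
  have hpos : ∫⁻ w, (ENNReal.log ‖z - w‖ₑ).toENNReal ∂ν =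
      ∫⁻ w, ENNReal.ofReal (log ‖z - w‖) ∂ν :=
    lintegral_congr_ae (hlog.mono fun w hw => by simp only [hw, toENNReal_coe_eq_ofReal])
  have hneg : ∫⁻ w, (-ENNReal.log ‖z - w‖ₑ).toENNReal ∂ν =
      ∫⁻ w, ENNReal.ofReal (-log ‖z - w‖) ∂ν :=
    lintegral_congr_ae (hlog.mono fun w hw => by
      simp only [hw, ← EReal.coe_neg, toENNReal_coe_eq_ofReal])
  have hneg_fin : ∫⁻ w, ENNReal.ofReal (-log ‖z - w‖) ∂ν ≠ ∞ :=
    hz.integrable_log.neg.lintegral_lt_top.ne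
  rw [logPotential, hpos, hneg, realPotential,
    integral_eq_lintegral_pos_part_sub_lintegral_neg_part hz.integrable_log, EReal.coe_sub,
    EReal.coe_ennreal_toReal hz.integrable_log.lintegral_lt_top.ne,
    EReal.coe_ennreal_toReal hneg_fin]

end Potential

section MaxPotential

/-- The function `max_k c_k U_{μ_k}` built from the real-valued potentials. It agrees almost
everywhere with `maxPotential c μ` if the measures have logarithmic moments. -/
def realMaxPotential {ι : Type*} (c : ι → ℝ) (μ : ι → Measure ℂ) (z : ℂ) : ℝ :=
  ⨆ k, c k * realPotential (μ k) z

section Finite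

variable {ι : Type*} [Finite ι] {c : ι → ℝ} {μ : ι → Measure ℂ}

theorem measurable_realMaxPotential [∀ k, SFinite (μ k)] : Measurable (realMaxPotential c μ) :=
  Measurable.iSup fun k => (measurable_realPotential (μ k)).const_mul (c k)

theorem mul_realPotential_le_realMaxPotential (k : ι) (z : ℂ) :
    c k * realPotential (μ k) z ≤ realMaxPotential c μ z :=
  le_ciSup (f := fun k => c k * realPotential (μ k) z) (Set.finite_range _).bddAbove k

variable [Nonempty ι]

theorem exists_realMaxPotential_eq (c : ι → ℝ) (μ : ι → Measure ℂ) (z : ℂ) :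
    ∃ k, realMaxPotential c μ z = c k * realPotential (μ k) z :=
  (exists_eq_ciSup_of_finite (f := fun k => c k * realPotential (μ k) z)).imp fun _ h => h.symm

theorem memLp_realMaxPotential [∀ k, IsProbabilityMeasure (μ k)]
    (hlog : ∀ k, HasLogMoment (μ k)) (R : ℝ) :
    MemLp (realMaxPotential c μ) 2 (volume.restrict (closedBall 0 R)) := by
  have := Fintype.ofFinite ι
  have hsum : MemLp (fun z => ∑ k, ‖c k * realPotential (μ k) z‖) 2
      (volume.restrict (closedBall 0 R)) :=
    memLp_finsetSum _ fun k _ => (((hlog k).memLp_realPotential R).const_mul (c k)).norm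
  refine hsum.mono' measurable_realMaxPotential.aestronglyMeasurable (ae_of_all _ fun z => ?_)
  obtain ⟨k, hk⟩ := exists_realMaxPotential_eq c μ z
  rw [hk]
  exact Finset.single_le_sum (f := fun k => ‖c k * realPotential (μ k) z‖)
    (fun j _ => norm_nonneg _) (Finset.mem_univ k)

end Finite

theorem scaledPotential_eq {ν : Measure ℂ} {z : ℂ} (hz : IsRegularPoint ν z) (a : ℝ) :
    scaledPotential a ν z = (a * realPotential ν z : ℝ) := by
  rw [scaledPotential, hz.logPotential_eq, EReal.coe_mul]
  split_ifs with ha <;> simp [ha]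

variable {m : ℕ} [Nonempty (Fin m)] {c : Fin m → ℝ} {μ : Fin m → Measure ℂ}

theorem maxPotential_eq_realMaxPotential {z : ℂ} (hz : ∀ k, IsRegularPoint (μ k) z) :
    maxPotential c μ z = realMaxPotential c μ z := by
  simp only [maxPotential, scaledPotential_eq (hz _)]
  refine le_antisymm
    (iSup_le fun k => EReal.coe_le_coe_iff.2 (mul_realPotential_le_realMaxPotential k z)) ?_
  obtain ⟨k, hk⟩ := exists_realMaxPotential_eq c μ z
  exact hk ▸ le_iSup (fun j => ((c j * realPotential (μ j) z : ℝ) : EReal)) k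

variable [∀ k, IsProbabilityMeasure (μ k)]

theorem ae_maxPotential_eq_realMaxPotential (hlog : ∀ k, HasLogMoment (μ k)) :
    ∀ᵐ z, maxPotential c μ z = realMaxPotential c μ z :=
  (ae_all_iff.2 fun k => (hlog k).ae_isRegularPoint).mono fun _ hz =>
    maxPotential_eq_realMaxPotential hz

theorem ae_maxPotential_ne_bot_and_ne_top (hlog : ∀ k, HasLogMoment (μ k)) :
    ∀ᵐ z, maxPotential c μ z ≠ ⊥ ∧ maxPotential c μ z ≠ ⊤ := by
  filter_upwards [ae_maxPotential_eq_realMaxPotential (c := c) hlog] with z hz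
  rw [hz]
  exact ⟨EReal.coe_ne_bot _, EReal.coe_ne_top _⟩

theorem locallyIntegrable_of_memLp_closedBall {E F : Type*} [PseudoMetricSpace E]
    [ProperSpace E] [Zero E] [MeasurableSpace E] [NormedAddCommGroup F] {μ : Measure E} {p : ℝ≥0∞}
    [IsFiniteMeasureOnCompacts μ] (hp : 1 ≤ p) {g : E → F}
    (hg : ∀ R, MemLp g p (μ.restrict (closedBall 0 R))) : LocallyIntegrable g μ := by
  refine fun x => ⟨closedBall 0 (dist x 0 + 1), mem_of_superset (ball_mem_nhds _ one_pos) ?_, ?_⟩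
  · exact ball_subset_closedBall.trans (closedBall_subset_closedBall' (by rw [add_comm]))
  · have : IsFiniteMeasure (μ.restrict (closedBall 0 (dist x 0 + 1))) :=
      isFiniteMeasure_restrict.2 measure_closedBall_lt_top.ne
    exact (hg _).integrable hp

theorem locallyIntegrable_toReal_maxPotential (hlog : ∀ k, HasLogMoment (μ k)) :
    LocallyIntegrable fun z => (maxPotential c μ z).toReal := by
  refine (locallyIntegrable_of_memLp_closedBall one_le_two
    (memLp_realMaxPotential (c := c) hlog)).congr ?_
  filter_upwards [ae_maxPotential_eq_realMaxPotential (c := c) hlog] with z hz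
  rw [hz, EReal.toReal_coe]

end MaxPotential

section Concentration

theorem integral_exp_neg_sq_div_two_eq_integral_charFun (ν : Measure ℝ) [IsFiniteMeasure ν] :
    ((∫ x, exp (-(x ^ 2 / 2)) ∂ν : ℝ) : ℂ) = ∫ t, charFun ν t ∂(gaussianReal 0 1) := by
  have hgauss (x : ℝ) : ((exp (-(x ^ 2 / 2)) : ℝ) : ℂ) =
      ∫ t : ℝ, Complex.exp (x * t * Complex.I) ∂(gaussianReal 0 1) := by
    rw [← charFun_apply_real, charFun_gaussianReal]
    push_cast
    congr 1
    simp
  have hint : Integrable (Function.uncurry fun x t : ℝ => Complex.exp (x * t * Complex.I))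
      (ν.prod (gaussianReal 0 1)) := by
    refine Integrable.of_bound (C := 1) (Continuous.aestronglyMeasurable (by fun_prop))
      (ae_of_all _ fun p => ?_)
    simp only [Function.uncurry_def, ← Complex.ofReal_mul, Complex.norm_exp_ofReal_mul_I, le_refl]
  simp_rw [← integral_complex_ofReal, hgauss, charFun_apply_real]
  rw [integral_integral_swap hint]
  simp_rw [mul_comm]

theorem measureReal_abs_le_one_le (ν : Measure ℝ) [IsFiniteMeasure ν] :
    ν.real {x | |x| ≤ 1} ≤ exp 2⁻¹ * ∫ t, ‖charFun ν t‖ ∂(gaussianReal 0 1) := by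
  have hset : MeasurableSet {x : ℝ | |x| ≤ 1} :=
    measurableSet_le continuous_abs.measurable measurable_const
  have hint : Integrable (fun x => exp (-(x ^ 2 / 2))) ν := by
    refine Integrable.of_bound (C := 1) (Continuous.aestronglyMeasurable (by fun_prop))
      (ae_of_all _ fun x => ?_)
    rw [norm_of_nonneg (exp_nonneg _), exp_le_one_iff]
    nlinarith [sq_nonneg x]
  calc ν.real {x | |x| ≤ 1}
      = ∫ x, {x : ℝ | |x| ≤ 1}.indicator 1 x ∂ν := (integral_indicator_one hset).symm
    _ ≤ ∫ x, exp 2⁻¹ * exp (-(x ^ 2 / 2)) ∂ν := by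
        refine integral_mono ((integrable_const (1 : ℝ)).indicator hset) (hint.const_mul _)
          (Set.indicator_le' (fun x hx => ?_) fun x _ => by positivity)
        rw [Pi.one_apply, ← exp_add, one_le_exp_iff]
        linarith [(sq_le_one_iff_abs_le_one x).2 hx]
    _ = exp 2⁻¹ * ∫ x, exp (-(x ^ 2 / 2)) ∂ν := integral_const_mul _ _
    _ ≤ exp 2⁻¹ * ∫ t, ‖charFun ν t‖ ∂(gaussianReal 0 1) := by
        gcongr
        refine (le_abs_self _).trans ?_
        rw [← norm_eq_abs, ← Complex.norm_real, integral_exp_neg_sq_div_two_eq_integral_charFun]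
        exact norm_integral_le_integral_norm _

variable {Ω : Type*} [MeasurableSpace Ω] {P : Measure Ω} [IsProbabilityMeasure P]

theorem norm_charFun_map_sub_le {E : Type*} [NormedAddCommGroup E] [InnerProductSpace ℝ E]
    [MeasurableSpace E] [BorelSpace E] [SecondCountableTopology E] {Y G : Ω → E}
    (hY : AEMeasurable Y P) (hG : AEMeasurable G P) (hYG : IndepFun Y G P) (t : E) :
    ‖charFun (P.map (Y - G)) t‖ ≤ ‖charFun (P.map Y) t‖ := by
  have : IsProbabilityMeasure (P.map (-G)) := Measure.isProbabilityMeasure_map hG.neg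
  have hind : IndepFun Y (-G) P := hYG.comp measurable_id measurable_neg
  rw [sub_eq_add_neg, hind.charFun_map_add_eq_mul hY hG.neg, Pi.mul_apply, norm_mul]
  exact mul_le_of_le_one_right (norm_nonneg _) (norm_charFun_le_one t)

theorem measureReal_abs_sub_le_one_le {Y G : Ω → ℝ} (hY : AEMeasurable Y P)
    (hG : AEMeasurable G P) (hYG : IndepFun Y G P) :
    P.real {ω | |Y ω - G ω| ≤ 1} ≤
      exp 2⁻¹ * ∫ t, ‖charFun (P.map Y) t‖ ∂(gaussianReal 0 1) := by
  have : IsProbabilityMeasure (P.map Y) := Measure.isProbabilityMeasure_map hY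
  have hset : MeasurableSet {x : ℝ | |x| ≤ 1} :=
    measurableSet_le continuous_abs.measurable measurable_const
  have hint : Integrable (fun t => ‖charFun (P.map Y) t‖) (gaussianReal 0 1) :=
    .of_bound (C := 1) measurable_charFun.norm.aestronglyMeasurable
      (ae_of_all _ fun t => by simpa using norm_charFun_le_one t)
  calc P.real {ω | |Y ω - G ω| ≤ 1}
      = (P.map (Y - G)).real {x | |x| ≤ 1} :=
        (map_measureReal_apply_of_aemeasurable (hY.sub hG) hset).symm
    _ ≤ exp 2⁻¹ * ∫ t, ‖charFun (P.map (Y - G)) t‖ ∂(gaussianReal 0 1) :=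
        measureReal_abs_le_one_le _
    _ ≤ exp 2⁻¹ * ∫ t, ‖charFun (P.map Y) t‖ ∂(gaussianReal 0 1) := by
        refine mul_le_mul_of_nonneg_left ?_ (exp_nonneg _)
        exact integral_mono_of_nonneg (ae_of_all _ fun _ => norm_nonneg _) hint
          (ae_of_all _ (norm_charFun_map_sub_le hY hG hYG))

theorem ae_exp_sub_mul_I_eq_one {Y : Ω → ℝ} (hY : Measurable Y) {t : ℝ}
    (h : 1 ≤ ‖charFun (P.map Y) t‖) :
    ∀ᵐ q ∂(P.prod P), Complex.exp ((t * (Y q.1 - Y q.2) : ℝ) * Complex.I) = 1 := by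
  let f : Ω → ℂ := fun ω => Complex.exp ((t * Y ω : ℝ) * Complex.I)
  have hf (ω : Ω) : ‖f ω‖ = 1 := Complex.norm_exp_ofReal_mul_I _
  have hchar : charFun (P.map Y) t = ∫ ω, f ω ∂P := by
    rw [charFun_apply_real, integral_map hY.aemeasurable
      (Continuous.aestronglyMeasurable (by fun_prop))]
    simp only [f, Complex.ofReal_mul]
  obtain hconst | hlt := ae_eq_const_or_norm_integral_lt_of_norm_le_const (μ := P) (f := f)
    (C := 1) (ae_of_all _ fun ω => (hf ω).le)
  · filter_upwards [Measure.quasiMeasurePreserving_fst.ae hconst,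
      Measure.quasiMeasurePreserving_snd.ae hconst] with q hq₁ hq₂
    have hquot : Complex.exp ((t * (Y q.1 - Y q.2) : ℝ) * Complex.I) = f q.1 / f q.2 := by
      rw [← Complex.exp_sub]
      push_cast
      ring_nf
    rw [hquot, hq₁.trans hq₂.symm]
    exact div_self (norm_ne_zero_iff.1 ((hf q.2).trans_ne one_ne_zero))
  · exact absurd h (not_le.2 (by simpa [hchar] using hlt))

theorem ae_norm_sub_ne {E : Type*} [NormedAddCommGroup E] [InnerProductSpace ℝ E]
    [FiniteDimensional ℝ E] [MeasurableSpace E] [BorelSpace E] (μ : Measure E)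
    [μ.IsAddHaarMeasure] {x y : E} (hxy : x ≠ y) : ∀ᵐ z ∂μ, ‖z - x‖ ≠ ‖z - y‖ := by
  have h : μ (AffineSubspace.perpBisector x y : Set E) = 0 :=
    Measure.addHaar_affineSubspace μ _ fun h => by simp [hxy] at h
  rw [ae_iff]
  convert h using 2
  ext z
  simp [AffineSubspace.mem_perpBisector_iff_dist_eq, dist_eq_norm]

theorem ae_exp_mul_mul_I_ne_one (γ : Measure ℝ) [NullSingletonClass γ] {v : ℝ} (hv : v ≠ 0) :
    ∀ᵐ t ∂γ, Complex.exp ((t * v : ℝ) * Complex.I) ≠ 1 := by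
  have hcount : {t : ℝ | Complex.exp ((t * v : ℝ) * Complex.I) = 1}.Countable := by
    refine (Set.countable_range fun k : ℤ => k * (2 * π) / v).mono fun t ht => ?_
    obtain ⟨k, hk⟩ := Complex.exp_eq_one_iff.1 ht
    have htv : t * v = k * (2 * π) := by
      refine Complex.ofReal_injective (mul_right_cancel₀ Complex.I_ne_zero (hk.trans ?_))
      push_cast
      ring
    exact ⟨k, by simp only [← htv, mul_div_cancel_right₀ t hv]⟩
  simpa only [ae_iff, not_not] using hcount.measure_zero γ

theorem ae_exp_log_sub_log_mul_I_ne_one (γ : Measure ℝ) [SFinite γ] [NullSingletonClass γ]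
    {x y : ℂ} (hxy : x ≠ y) :
    ∀ᵐ p ∂((volume : Measure ℂ).prod γ),
      Complex.exp ((p.2 * (log ‖p.1 - x‖ - log ‖p.1 - y‖) : ℝ) * Complex.I) ≠ 1 := by
  have hmeas : MeasurableSet {p : ℂ × ℝ |
      Complex.exp ((p.2 * (log ‖p.1 - x‖ - log ‖p.1 - y‖) : ℝ) * Complex.I) ≠ 1} :=
    (measurableSet_eq_fun (by fun_prop) measurable_const).compl
  rw [Measure.ae_prod_iff_ae_ae hmeas]
  filter_upwards [ae_norm_sub_ne volume hxy, Measure.ae_ne volume x, Measure.ae_ne volume y]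
    with z hz hzx hzy
  refine ae_exp_mul_mul_I_ne_one γ fun h => hz ?_
  exact log_injOn_pos (norm_pos_iff.2 (sub_ne_zero.2 hzx)) (norm_pos_iff.2 (sub_ne_zero.2 hzy))
    (sub_eq_zero.1 h)

theorem NonDegenerate.not_ae_fst_eq_snd {μ : Measure ℂ} [IsProbabilityMeasure μ]
    (hμ : NonDegenerate μ) : ¬ ∀ᵐ q ∂(μ.prod μ), q.1 = q.2 := by
  intro h
  obtain ⟨x, hx⟩ := (Measure.ae_ae_of_ae_prod h).exists
  have hmap : μ.map id = μ.map fun _ => x := Measure.map_congr (hx.mono fun _ => Eq.symm)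
  exact hμ x (by simpa [Measure.map_const] using hmap)

theorem NonDegenerate.ae_norm_charFun_lt_one {μ : Measure ℂ} [IsProbabilityMeasure μ]
    (hμ : NonDegenerate μ) (γ : Measure ℝ) [SFinite γ] [NullSingletonClass γ] :
    ∀ᵐ z : ℂ, ∀ᵐ t ∂γ, ‖charFun (μ.map fun x => log ‖z - x‖) t‖ < 1 := by
  have hoff : ∀ᵐ p ∂((volume : Measure ℂ).prod γ), ∀ᵐ q ∂(μ.prod μ), q.1 ≠ q.2 →
      Complex.exp ((p.2 * (log ‖p.1 - q.1‖ - log ‖p.1 - q.2‖) : ℝ) * Complex.I) ≠ 1 := by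
    rw [Measure.ae_ae_comm]
    · refine ae_of_all _ fun q => ?_
      by_cases hq : q.1 = q.2
      · simp [hq]
      · simpa [hq] using ae_exp_log_sub_log_mul_I_ne_one γ hq
    · simp only [ne_eq, ← or_iff_not_imp_left]
      exact (measurableSet_eq_fun (by fun_prop) (by fun_prop)).union
        (measurableSet_eq_fun (by fun_prop) measurable_const).compl
  filter_upwards [Measure.ae_ae_of_ae_prod hoff] with z hz
  filter_upwards [hz] with t ht
  by_contra! hge
  refine hμ.not_ae_fst_eq_snd ?_
  filter_upwards [ht, ae_exp_sub_mul_I_eq_one (Y := fun x => log ‖z - x‖) (by fun_prop) hge]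
    with q hq hq_one
  exact not_not.1 fun hne => hq hne hq_one

theorem tendsto_integral_norm_pow_zero {α E : Type*} [MeasurableSpace α] [NormedAddCommGroup E]
    {γ : Measure α} [IsFiniteMeasure γ] {χ : α → E} (hχ : AEStronglyMeasurable χ γ)
    (h : ∀ᵐ t ∂γ, ‖χ t‖ < 1) : Tendsto (fun N : ℕ => ∫ t, ‖χ t‖ ^ N ∂γ) atTop (𝓝 0) := by
  rw [← integral_zero α ℝ]
  refine tendsto_integral_of_dominated_convergence (fun _ => 1) (fun N => hχ.norm.pow N)
    (integrable_const 1) (fun N => ?_) ?_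
  · filter_upwards [h] with t ht
    rw [norm_pow, norm_norm]
    exact pow_le_one₀ (norm_nonneg _) ht.le
  · filter_upwards [h] with t ht
    exact tendsto_pow_atTop_nhds_zero_of_lt_one (norm_nonneg _) ht

end Concentration

section RootPoly

variable {ι : Type*} (M : Finset ι) (x : ι → ℕ → ℂ) {δ : ι → ℕ} {n : ℕ}

theorem monic_rootPoly (x : ℕ → ℂ) (d : ℕ) : (rootPoly x d).Monic := monic_prod_X_sub_C _ _

theorem natDegree_rootPoly (x : ℕ → ℂ) (d : ℕ) : (rootPoly x d).natDegree = d := by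
  rw [rootPoly, natDegree_finsetProd_X_sub_C_eq_card, Finset.card_range]

theorem eval_rootPoly (x : ℕ → ℂ) (d : ℕ) (z : ℂ) :
    (rootPoly x d).eval z = ∏ i ∈ Finset.range d, (z - x i) := by
  simp only [rootPoly, eval_prod, eval_sub, eval_X, eval_C]

theorem coeff_sum_rootPoly (hle : ∀ k ∈ M, δ k ≤ n) :
    (∑ k ∈ M, rootPoly (x k) (δ k)).coeff n = ((M.filter fun k => δ k = n).card : ℂ) := by
  rw [finsetSum_coeff, Finset.card_filter, Nat.cast_sum]
  refine Finset.sum_congr rfl fun k hk => ?_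
  split_ifs with h
  · rw [← h, Nat.cast_one, ← (monic_rootPoly (x k) (δ k)).coeff_natDegree, natDegree_rootPoly]
  · rw [Nat.cast_zero]
    exact coeff_eq_zero_of_natDegree_lt ((natDegree_rootPoly _ _).trans_lt ((hle k hk).lt_of_ne h))

variable {M}

theorem coeff_sum_rootPoly_ne_zero (hle : ∀ k ∈ M, δ k ≤ n) (hn : ∃ k ∈ M, δ k = n) :
    (∑ k ∈ M, rootPoly (x k) (δ k)).coeff n ≠ 0 := by
  rw [coeff_sum_rootPoly M x hle, Nat.cast_ne_zero, Finset.card_ne_zero]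
  obtain ⟨k, hk, hkn⟩ := hn
  exact ⟨k, Finset.mem_filter.2 ⟨hk, hkn⟩⟩

theorem sum_rootPoly_ne_zero (hM : M.Nonempty) (δ : ι → ℕ) :
    ∑ k ∈ M, rootPoly (x k) (δ k) ≠ 0 := by
  obtain ⟨k, hk, hmax⟩ := M.exists_max_image δ hM
  intro h
  exact coeff_sum_rootPoly_ne_zero x hmax ⟨k, hk, rfl⟩ (by rw [h, coeff_zero])

theorem natDegree_sum_rootPoly (hle : ∀ k ∈ M, δ k ≤ n) (hn : ∃ k ∈ M, δ k = n) :
    (∑ k ∈ M, rootPoly (x k) (δ k)).natDegree = n :=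
  natDegree_eq_of_le_of_coeff_ne_zero
    (natDegree_sum_le_of_forall_le _ _ fun k hk => (natDegree_rootPoly _ _).trans_le (hle k hk))
    (coeff_sum_rootPoly_ne_zero x hle hn)

theorem norm_leadingCoeff_sum_rootPoly_mem_Icc (hle : ∀ k ∈ M, δ k ≤ n)
    (hn : ∃ k ∈ M, δ k = n) :
    ‖(∑ k ∈ M, rootPoly (x k) (δ k)).leadingCoeff‖ ∈ Set.Icc (1 : ℝ) M.card := by
  have hne := coeff_sum_rootPoly_ne_zero x hle hn
  rw [leadingCoeff, natDegree_sum_rootPoly x hle hn]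
  rw [coeff_sum_rootPoly M x hle] at hne ⊢
  rw [Complex.norm_natCast]
  exact ⟨Nat.one_le_cast.2 (Nat.one_le_iff_ne_zero.2 (Nat.cast_ne_zero.1 hne)),
    Nat.cast_le.2 (Finset.card_filter_le _ _)⟩

end RootPoly

section EmpiricalRootMeasure

variable {E : Type*} [NormedAddCommGroup E]

theorem integrable_sum_dirac (s : Multiset ℂ) (f : ℂ → E) :
    Integrable f (s.map Measure.dirac).sum := by
  induction s using Multiset.induction with
  | empty => exact integrable_zero_measure
  | cons a s ih =>
    rw [Multiset.map_cons, Multiset.sum_cons]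
    exact (integrable_dirac enorm_lt_top).add_measure ih

theorem integral_sum_dirac [NormedSpace ℝ E] [CompleteSpace E] (s : Multiset ℂ) (f : ℂ → E) :
    ∫ z, f z ∂(s.map Measure.dirac).sum = (s.map f).sum := by
  induction s using Multiset.induction with
  | empty => exact integral_zero_measure f
  | cons a s ih =>
    rw [Multiset.map_cons, Multiset.sum_cons, integral_add_measure (integrable_dirac enorm_lt_top)
      (integrable_sum_dirac s f), ih, Multiset.map_cons, Multiset.sum_cons, integral_dirac]

theorem sum_dirac_univ (s : Multiset ℂ) : (s.map Measure.dirac).sum Set.univ = s.card := by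
  induction s using Multiset.induction with
  | empty => simp
  | cons a s ih =>
    rw [Multiset.map_cons, Multiset.sum_cons, Measure.add_apply, ih, measure_univ,
      Multiset.card_cons, Nat.cast_add, Nat.cast_one, add_comm]

theorem integral_empiricalRootMeasure [NormedSpace ℝ E] [CompleteSpace E] (n : ℕ) (p : ℂ[X])
    (f : ℂ → E) : ∫ z, f z ∂(empiricalRootMeasure n p) = (n : ℝ)⁻¹ • (p.roots.map f).sum := by
  rw [empiricalRootMeasure, integral_smul_measure, integral_sum_dirac, ENNReal.toReal_inv,
    ENNReal.toReal_natCast]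

theorem integrable_empiricalRootMeasure {n : ℕ} (hn : n ≠ 0) (p : ℂ[X]) (f : ℂ → E) :
    Integrable f (empiricalRootMeasure n p) :=
  (integrable_sum_dirac _ f).smul_measure (ENNReal.inv_ne_top.2 (Nat.cast_ne_zero.2 hn))

theorem isProbabilityMeasure_empiricalRootMeasure {n : ℕ} (hn : n ≠ 0) {p : ℂ[X]}
    (hp : p.natDegree = n) : IsProbabilityMeasure (empiricalRootMeasure n p) where
  measure_univ := by
    rw [empiricalRootMeasure, Measure.smul_apply, sum_dirac_univ,
      IsAlgClosed.card_roots_eq_natDegree, hp, smul_eq_mul]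
    exact ENNReal.inv_mul_cancel (Nat.cast_ne_zero.2 hn) (ENNReal.natCast_ne_top n)

theorem log_norm_eval_eq {p : ℂ[X]} {z : ℂ} (hz : p.eval z ≠ 0) :
    log ‖p.eval z‖ = log ‖p.leadingCoeff‖ + (p.roots.map fun r => log ‖z - r‖).sum := by
  have hp : p ≠ 0 := fun h => hz (by rw [h, eval_zero])
  have hroots : ∀ a ∈ p.roots.map fun r => ‖z - r‖, a ≠ 0 := by
    intro a ha
    obtain ⟨r, hr, rfl⟩ := Multiset.mem_map.1 ha
    refine norm_ne_zero_iff.2 (sub_ne_zero.2 ?_)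
    rintro rfl
    exact hz ((mem_roots hp).1 hr)
  have hprod : ‖p.eval z‖ = ‖p.leadingCoeff‖ * (p.roots.map fun r => ‖z - r‖).prod := by
    conv_lhs => rw [(IsAlgClosed.splits p).eval_eq_prod_roots]
    rw [norm_mul]
    exact congrArg _ (Multiset.prod_hom' p.roots (normHom : ℂ →*₀ ℝ) fun r => z - r).symm
  rw [hprod, log_mul (norm_ne_zero_iff.2 (leadingCoeff_ne_zero.2 hp))
    (Multiset.prod_ne_zero fun h => hroots 0 h rfl), log_multiset_prod hroots, Multiset.map_map]
  rfl

theorem ae_eval_ne_zero {p : ℂ[X]} (hp : p ≠ 0) : ∀ᵐ z : ℂ, p.eval z ≠ 0 := by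
  have hroots : {z : ℂ | ¬ p.eval z ≠ 0} = p.rootSet ℂ := by
    ext z
    simp [mem_rootSet, hp]
  rw [ae_iff, hroots]
  exact (rootSet_finite p ℂ).measure_zero _

theorem ae_inv_mul_log_norm_eval_eq (n : ℕ) {p : ℂ[X]} (hp : p ≠ 0) :
    ∀ᵐ z : ℂ, (n : ℝ)⁻¹ * log ‖p.eval z‖ =
      (n : ℝ)⁻¹ * log ‖p.leadingCoeff‖ + realPotential (empiricalRootMeasure n p) z := by
  filter_upwards [ae_eval_ne_zero hp] with z hz
  rw [log_norm_eval_eq hz, realPotential, integral_empiricalRootMeasure, smul_eq_mul, mul_add]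

-- Jensen's formula
theorem sum_posLog_roots_le {p : ℂ[X]} (hlead : 1 ≤ ‖p.leadingCoeff‖) {B : ℝ} (hB : 0 ≤ B)
    (hbound : ∀ z : ℂ, ‖z‖ = 1 → ‖p.eval z‖ ≤ exp B) : (p.roots.map fun r => log⁺ ‖r‖).sum ≤ B := by
  have hmahler : p.logMahlerMeasure ≤ B := by
    rw [logMahlerMeasure_def]
    refine circleAverage_mono_on_of_le_circle p.intervalIntegrable_mahlerMeasure fun z hz => ?_
    rw [mem_sphere_zero_iff_norm, abs_one] at hz
    rcases eq_or_ne (p.eval z) 0 with h | h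
    · simpa only [h, norm_zero, log_zero] using hB
    · exact (log_le_iff_le_exp (norm_pos_iff.2 h)).2 (hbound z hz)
  linarith [logMahlerMeasure_eq_log_leadingCoeff_add_sum_log_roots p, log_nonneg hlead]

theorem logMoment_empiricalRootMeasure_le {n : ℕ} (hn : n ≠ 0) {p : ℂ[X]}
    (hlead : 1 ≤ ‖p.leadingCoeff‖) {B : ℝ} (hB : 0 ≤ B)
    (hbound : ∀ z : ℂ, ‖z‖ = 1 → ‖p.eval z‖ ≤ exp (n * B)) :
    logMoment (empiricalRootMeasure n p) ≤ ENNReal.ofReal B := by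
  have hn_pos : (0 : ℝ) < n := Nat.cast_pos.2 (Nat.pos_of_ne_zero hn)
  rw [logMoment, ← ofReal_integral_norm_eq_lintegral_enorm (integrable_empiricalRootMeasure hn p _)]
  simp_rw [norm_of_nonneg posLog_nonneg]
  rw [integral_empiricalRootMeasure, smul_eq_mul]
  refine ENNReal.ofReal_le_ofReal ((inv_mul_le_iff₀ hn_pos).2 ?_)
  exact sum_posLog_roots_le hlead (by positivity) hbound

end EmpiricalRootMeasure

section LogSize

variable {ι : Type*} [Fintype ι]

/-- The average over `i < n` of the total logarithmic size `∑ k, log⁺ ‖x k i‖`, which controls the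
logarithmic moment of the zeros of sums of monic polynomials with roots `x k i`. -/
def averageLogSize (x : ι → ℕ → ℂ) (n : ℕ) : ℝ :=
  (n : ℝ)⁻¹ * ∑ k, ∑ i ∈ Finset.range n, log⁺ ‖x k i‖

theorem averageLogSize_nonneg (x : ι → ℕ → ℂ) (n : ℕ) : 0 ≤ averageLogSize x n :=
  mul_nonneg (by positivity)
    (Finset.sum_nonneg fun _ _ => Finset.sum_nonneg fun _ _ => posLog_nonneg)

theorem norm_eval_rootPoly_le (x : ℕ → ℂ) {z : ℂ} (hz : ‖z‖ ≤ 1) (d : ℕ) :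
    ‖(rootPoly x d).eval z‖ ≤ exp (d * log 2 + ∑ i ∈ Finset.range d, log⁺ ‖x i‖) := by
  have hfactor (i : ℕ) : ‖z - x i‖ ≤ exp (log 2 + log⁺ ‖x i‖) := by
    rw [exp_add, exp_log two_pos, posLog_eq_log_max_one (norm_nonneg _),
      exp_log (lt_max_of_lt_left one_pos)]
    linarith [norm_sub_le z (x i), le_max_left 1 ‖x i‖, le_max_right 1 ‖x i‖]
  rw [eval_rootPoly, norm_prod]
  refine (Finset.prod_le_prod (fun _ _ => norm_nonneg _) fun i _ => hfactor i).trans_eq ?_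
  rw [← exp_sum, Finset.sum_add_distrib, Finset.sum_const, Finset.card_range, nsmul_eq_mul]

theorem norm_eval_rootPoly_le_exp_averageLogSize (x : ι → ℕ → ℂ) {n : ℕ} {z : ℂ} (hz : ‖z‖ ≤ 1)
    (k : ι) {d : ℕ} (hd : d ≤ n) :
    ‖(rootPoly (x k) d).eval z‖ ≤ exp (n * (log 2 + averageLogSize x n)) := by
  rcases eq_or_ne n 0 with rfl | hn
  · simpa [Nat.le_zero.1 hd] using norm_eval_rootPoly_le (x k) hz 0
  refine (norm_eval_rootPoly_le (x k) hz d).trans (exp_le_exp.2 ?_)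
  rw [mul_add, averageLogSize, mul_inv_cancel_left₀ (Nat.cast_ne_zero.2 hn)]
  gcongr
  calc ∑ i ∈ Finset.range d, log⁺ ‖x k i‖
      ≤ ∑ i ∈ Finset.range n, log⁺ ‖x k i‖ :=
        Finset.sum_le_sum_of_subset_of_nonneg (Finset.range_mono hd) fun _ _ _ => posLog_nonneg
    _ ≤ ∑ k, ∑ i ∈ Finset.range n, log⁺ ‖x k i‖ :=
        Finset.single_le_sum (f := fun k => ∑ i ∈ Finset.range n, log⁺ ‖x k i‖)
          (fun _ _ => Finset.sum_nonneg fun _ _ => posLog_nonneg) (Finset.mem_univ k)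

theorem logMoment_empiricalRootMeasure_sum_rootPoly_le (x : ι → ℕ → ℂ) {δ : ι → ℕ} {n : ℕ}
    (hn : n ≠ 0) (hle : ∀ k, δ k ≤ n) (hmax : ∃ k, δ k = n) :
    logMoment (empiricalRootMeasure n (∑ k, rootPoly (x k) (δ k))) ≤
      ENNReal.ofReal (log (Fintype.card ι) + log 2 + averageLogSize x n) := by
  have hlead := norm_leadingCoeff_sum_rootPoly_mem_Icc (M := Finset.univ) x (fun k _ => hle k)
    (by simpa only [Finset.mem_univ, true_and] using hmax)
  have hcard : (1 : ℝ) ≤ Fintype.card ι := hlead.1.trans hlead.2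
  have hlog_card : 0 ≤ log (Fintype.card ι) := log_nonneg hcard
  have hsize := averageLogSize_nonneg x n
  refine logMoment_empiricalRootMeasure_le hn hlead.1 (by positivity) fun z hz => ?_
  calc ‖(∑ k, rootPoly (x k) (δ k)).eval z‖
      ≤ ∑ _k : ι, exp (n * (log 2 + averageLogSize x n)) := by
        rw [eval_finsetSum]
        exact norm_sum_le_of_le _ fun k _ =>
          norm_eval_rootPoly_le_exp_averageLogSize x hz.le k (hle k)
    _ = exp (log (Fintype.card ι) + n * (log 2 + averageLogSize x n)) := by
        rw [exp_add, exp_log (by linarith), Finset.sum_const, Finset.card_univ, nsmul_eq_mul]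
    _ ≤ exp (n * (log (Fintype.card ι) + log 2 + averageLogSize x n)) := by
        rw [add_assoc (log _), exp_le_exp, mul_add (n : ℝ) (log (Fintype.card ι))]
        refine add_le_add (le_mul_of_one_le_left hlog_card ?_) le_rfl
        exact Nat.one_le_cast.2 (Nat.one_le_iff_ne_zero.2 hn)

end LogSize

section Asymptotics

theorem tendsto_atTop_or_exists_eventually_eq {α : Type*} (g : Ultrafilter α) (d : α → ℕ) :
    Tendsto d g atTop ∨ ∃ N, ∀ᶠ n in g, d n = N := by
  obtain h | ⟨N, hN⟩ := (g.map d).le_cofinite_or_eq_pure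
  · exact .inl (by rwa [Nat.cofinite_eq_atTop] at h)
  · exact .inr ⟨N, (show {N} ∈ g.map d by rw [hN]; exact Set.mem_singleton N)⟩

theorem eq_zero_of_tendsto_div_of_eventually_eq {g : Filter ℕ} [g.NeBot] (hg : g ≤ atTop)
    {d : ℕ → ℕ} {c : ℝ} (hc : Tendsto (fun n => (d n : ℝ) / n) g (𝓝 c)) {N : ℕ}
    (hN : ∀ᶠ n in g, d n = N) : c = 0 := by
  have hzero := (tendsto_const_div_atTop_nhds_zero_nat (N : ℝ)).mono_left hg
  refine tendsto_nhds_unique hc (hzero.congr' ?_)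
  filter_upwards [hN] with n hn
  rw [hn]

theorem tendsto_comp_div {s : ℕ → ℝ} {u c : ℝ} (hs : Tendsto (fun N : ℕ => s N / N) atTop (𝓝 u))
    {d : ℕ → ℕ} (hd : Tendsto (fun n : ℕ => (d n : ℝ) / n) atTop (𝓝 c)) :
    Tendsto (fun n : ℕ => s (d n) / n) atTop (𝓝 (c * u)) := by
  refine tendsto_iff_ultrafilter _ _ _ |>.2 fun g hg => ?_
  obtain hd_top | ⟨N, hN⟩ := tendsto_atTop_or_exists_eventually_eq g d
  · refine ((hd.mono_left hg).mul (hs.comp hd_top)).congr' ?_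
    filter_upwards [hd_top.eventually_ne_atTop 0] with n hn
    rw [Function.comp_apply, mul_comm, div_mul_div_cancel₀ (Nat.cast_ne_zero.2 hn)]
  · rw [eq_zero_of_tendsto_div_of_eventually_eq hg (hd.mono_left hg) hN, zero_mul]
    refine ((tendsto_const_div_atTop_nhds_zero_nat (s N)).mono_left hg).congr' ?_
    filter_upwards [hN] with n hn
    rw [hn]

theorem tendsto_exp_natCast_mul_nhds_zero {b : ℝ} (hb : b < 0) :
    Tendsto (fun n : ℕ => exp (n * b)) atTop (𝓝 0) :=
  tendsto_exp_atBot.comp (tendsto_natCast_atTop_atTop.atTop_mul_const_of_neg hb)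

variable {r : ℕ → ℝ} {a b : ℝ}

theorem tendsto_exp_mul_mul_nhds_zero (hr : ∀ n, 0 ≤ r n)
    (h : Tendsto (fun n : ℕ => log (r n) / n) atTop (𝓝 a)) (hab : a < b) :
    Tendsto (fun n : ℕ => exp (-(n * b)) * r n) atTop (𝓝 0) := by
  obtain ⟨b', hab', hb'⟩ := exists_between hab
  refine squeeze_zero' (.of_forall fun n => mul_nonneg (exp_nonneg _) (hr n)) ?_
    (tendsto_exp_natCast_mul_nhds_zero (sub_neg.2 hb'))
  filter_upwards [h.eventually_lt_const hab', eventually_gt_atTop 0] with n hn hn_pos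
  calc exp (-(n * b)) * r n
      ≤ exp (-(n * b)) * exp (n * b') := by
        gcongr
        refine (le_exp_log _).trans (exp_le_exp.2 ?_)
        exact ((div_lt_iff₀' (Nat.cast_pos.2 hn_pos)).1 hn).le
    _ = exp (n * (b' - b)) := by
        rw [← exp_add]
        ring_nf

theorem eventually_exp_mul_le (hr : ∀ n, 0 < r n)
    (h : Tendsto (fun n : ℕ => log (r n) / n) atTop (𝓝 a)) (hba : b < a) :
    ∀ᶠ n : ℕ in atTop, exp (n * b) ≤ r n := by
  filter_upwards [h.eventually_const_lt hba, eventually_gt_atTop 0] with n hn hn_pos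
  exact (le_log_iff_exp_le (hr n)).1 ((lt_div_iff₀' (Nat.cast_pos.2 hn_pos)).1 hn).le

theorem abs_log_norm_sub_log_norm_le_one {E : Type*} [SeminormedAddCommGroup E] {v w : E}
    (hv : 0 < ‖v‖) (h : ‖v + w‖ ≤ ‖v‖ / 2) : |log ‖v‖ - log ‖w‖| ≤ 1 := by
  have hw_lower : ‖v‖ / 2 ≤ ‖w‖ := by
    have := norm_sub_le (v + w) w
    rw [add_sub_cancel_right] at this
    linarith
  have hw_upper : ‖w‖ ≤ 2 * ‖v‖ := by
    have := norm_sub_le (v + w) v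
    rw [add_sub_cancel_left] at this
    linarith
  have hw : 0 < ‖w‖ := by linarith
  have hlog_two : log 2 ≤ 1 := log_two_lt_d9.le.trans (by norm_num)
  have hlog_lower := log_le_log (by linarith) hw_lower
  have hlog_upper := log_le_log hw hw_upper
  rw [log_div hv.ne' two_ne_zero] at hlog_lower
  rw [log_mul two_ne_zero hv.ne'] at hlog_upper
  exact abs_sub_le_iff.2 ⟨by linarith, by linarith⟩

theorem tendsto_measure_zero_of_ae_eventually_notMem {Ω : Type*} [MeasurableSpace Ω]
    {P : Measure Ω} [IsFiniteMeasure P] {E : ℕ → Set Ω} (hE : ∀ n, MeasurableSet (E n))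
    (h : ∀ᵐ ω ∂P, ∀ᶠ n in atTop, ω ∉ E n) : Tendsto (fun n => P (E n)) atTop (𝓝 0) := by
  rw [← measure_empty (μ := P)]
  refine tendsto_measure_of_ae_tendsto_indicator_of_isFiniteMeasure atTop .empty hE ?_
  filter_upwards [h] with ω hω
  filter_upwards [hω] with n hn
  exact iff_of_false hn (Set.notMem_empty ω)

end Asymptotics

section Sample

variable {ι Ω : Type*}

/-- The value `p_{N,k}(z)` at `z` of the random polynomial with roots `X 0 k, …, X (N - 1) k`. -/
def polyValue (X : ℕ → ι → Ω → ℂ) (z : ℂ) (k : ι) (N : ℕ) (ω : Ω) : ℂ :=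
  (rootPoly (fun i => X i k ω) N).eval z

theorem polyValue_eq_prod (X : ℕ → ι → Ω → ℂ) (z : ℂ) (k : ι) (N : ℕ) (ω : Ω) :
    polyValue X z k N ω = ∏ i ∈ Finset.range N, (z - X i k ω) :=
  eval_rootPoly _ _ _

variable [MeasurableSpace Ω]

/-- `X i k` is a family of independent random variables such that `X i k` has law `μ k`. -/
structure IsSample (P : Measure Ω) (μ : ι → Measure ℂ) (X : ℕ → ι → Ω → ℂ) : Prop where
  measurable : ∀ i k, Measurable (X i k)
  indep : iIndepFun (fun ik : ℕ × ι => X ik.1 ik.2) P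
  law : ∀ i k, P.map (X i k) = μ k

variable {P : Measure Ω} {μ : ι → Measure ℂ} {X : ℕ → ι → Ω → ℂ}

namespace IsSample

theorem measurable_polyValue_uncurry (hX : IsSample P μ X) (k : ι) (N : ℕ) :
    Measurable fun p : ℂ × Ω => polyValue X p.1 k N p.2 := by
  simp_rw [polyValue_eq_prod]
  exact Finset.measurable_fun_prod _ fun i _ =>
    measurable_fst.sub ((hX.measurable i k).comp measurable_snd)

theorem measurable_polyValue (hX : IsSample P μ X) (z : ℂ) (k : ι) (N : ℕ) :
    Measurable (polyValue X z k N) :=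
  (hX.measurable_polyValue_uncurry k N).comp measurable_prodMk_left

theorem measurable_sum_polyValue (hX : IsSample P μ X) (z : ℂ) (s : Finset ι) (δ : ι → ℕ) :
    Measurable fun ω => ∑ k ∈ s, polyValue X z k (δ k) ω :=
  Finset.measurable_fun_sum _ fun k _ => hX.measurable_polyValue z k (δ k)

theorem identDistrib (hX : IsSample P μ X) (i j : ℕ) (k : ι) :
    IdentDistrib (X i k) (X j k) P P :=
  ⟨(hX.measurable i k).aemeasurable, (hX.measurable j k).aemeasurable, by rw [hX.law, hX.law]⟩

theorem ae_tendsto_average (hX : IsSample P μ X) (k : ι) {h : ℂ → ℝ} (hh : Measurable h)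
    (hint : Integrable h (μ k)) :
    ∀ᵐ ω ∂P, Tendsto (fun N : ℕ => (∑ i ∈ Finset.range N, h (X i k ω)) / N) atTop
      (𝓝 (∫ w, h w ∂(μ k))) := by
  rw [← hX.law 0 k, integral_map (hX.measurable 0 k).aemeasurable hh.aestronglyMeasurable]
  rw [← hX.law 0 k] at hint
  refine strong_law_ae_real (fun i ω => h (X i k ω)) (hint.comp_measurable (hX.measurable 0 k))
    (fun i j hij => ?_) fun i => (hX.identDistrib i 0 k).comp hh
  have hne : (i, k) ≠ (j, k) := fun hk => hij (congrArg Prod.fst hk)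
  exact (hX.indep.indepFun hne).comp hh hh

theorem ae_forall_ne (hX : IsSample P μ X) {z : ℂ} {k : ι} (hz : IsRegularPoint (μ k) z) :
    ∀ᵐ ω ∂P, ∀ i, X i k ω ≠ z := by
  refine ae_all_iff.2 fun i => ae_of_ae_map (p := (· ≠ z)) (hX.measurable i k).aemeasurable ?_
  rw [hX.law]
  exact hz.ae_ne

theorem ae_forall_polyValue_ne_zero (hX : IsSample P μ X) {z : ℂ} {k : ι}
    (hz : IsRegularPoint (μ k) z) : ∀ᵐ ω ∂P, ∀ N, polyValue X z k N ω ≠ 0 := by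
  filter_upwards [hX.ae_forall_ne hz] with ω hω N
  rw [polyValue_eq_prod]
  exact Finset.prod_ne_zero_iff.2 fun i _ => sub_ne_zero.2 (hω i).symm

theorem ae_forall_log_norm_polyValue_eq (hX : IsSample P μ X) {z : ℂ} {k : ι}
    (hz : IsRegularPoint (μ k) z) : ∀ᵐ ω ∂P, ∀ N,
      log ‖polyValue X z k N ω‖ = ∑ i ∈ Finset.range N, log ‖z - X i k ω‖ := by
  filter_upwards [hX.ae_forall_ne hz] with ω hω N
  rw [polyValue_eq_prod, norm_prod,
    log_prod fun i _ => norm_ne_zero_iff.2 (sub_ne_zero.2 (hω i).symm)]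

theorem ae_tendsto_log_norm_polyValue_div (hX : IsSample P μ X) {z : ℂ} {k : ι}
    (hz : IsRegularPoint (μ k) z) {d : ℕ → ℕ} {c : ℝ}
    (hd : Tendsto (fun n : ℕ => (d n : ℝ) / n) atTop (𝓝 c)) :
    ∀ᵐ ω ∂P, Tendsto (fun n : ℕ => log ‖polyValue X z k (d n) ω‖ / n) atTop
      (𝓝 (c * realPotential (μ k) z)) := by
  filter_upwards [hX.ae_tendsto_average k (by fun_prop) hz.integrable_log,
    hX.ae_forall_log_norm_polyValue_eq hz] with ω hω hω_log
  simp_rw [← hω_log] at hω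
  exact tendsto_comp_div hω hd

theorem indepFun_polyValue_sum (hX : IsSample P μ X) (z : ℂ) {k : ι} {s : Finset ι} (hk : k ∉ s)
    (δ : ι → ℕ) :
    IndepFun (polyValue X z k (δ k)) (fun ω => ∑ j ∈ s, polyValue X z j (δ j) ω) P := by
  let σ : ℕ × ι → MeasurableSpace Ω := fun ik => .comap (X ik.1 ik.2) inferInstance
  have hdisj : Disjoint {ik : ℕ × ι | ik.2 = k} {ik | ik.2 ∈ s} :=
    Set.disjoint_left.2 fun ik hik hik_mem => hk (hik ▸ hik_mem)
  have hmeas {S : Set (ℕ × ι)} {j : ι} (hj : ∀ i, (i, j) ∈ S) (N : ℕ) :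
      Measurable[⨆ i ∈ S, σ i] (polyValue X z j N) := by
    rw [funext (polyValue_eq_prod X z j N)]
    exact Finset.measurable_fun_prod _ fun i _ => (measurable_const_sub z).comp
      ((comap_measurable (X i j)).mono (le_iSup₂_of_le (i, j) (hj i) le_rfl) le_rfl)
  refine indep_of_indep_of_le_left (indep_of_indep_of_le_right
    (indep_iSup_of_disjoint (m := σ) (fun ik => (hX.measurable ik.1 ik.2).comap_le) hX.indep hdisj)
    (Measurable.comap_le ?_)) (Measurable.comap_le ?_)
  · exact Finset.measurable_fun_sum _ fun j hj => hmeas (fun _ => hj) (δ j)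
  · exact hmeas (fun _ => rfl) (δ k)

theorem charFun_map_log_norm_polyValue (hX : IsSample P μ X) {z : ℂ} {k : ι}
    (hz : IsRegularPoint (μ k) z) (N : ℕ) (t : ℝ) :
    charFun (P.map fun ω => log ‖polyValue X z k N ω‖) t =
      charFun ((μ k).map fun w => log ‖z - w‖) t ^ N := by
  have hlog : Measurable fun w : ℂ => log ‖z - w‖ := by fun_prop
  have hinj : Function.Injective fun i : Finset.range N => ((i : ℕ), k) := fun a b h =>
    Subtype.ext (congrArg Prod.fst h)
  have hlaw (i : ℕ) : P.map (fun ω => log ‖z - X i k ω‖) = (μ k).map fun w => log ‖z - w‖ := by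
    rw [← hX.law i k, Measure.map_map hlog (hX.measurable i k)]
    rfl
  rw [Measure.map_congr ((hX.ae_forall_log_norm_polyValue_eq hz).mono fun _ h => h N),
    iIndepFun.charFun_map_fun_finsetSum_eq_prod (X := fun i ω => log ‖z - X i k ω‖)
      (fun i _ => (hlog.comp (hX.measurable i k)).aemeasurable)
      ((hX.indep.precomp hinj).comp (fun _ w => log ‖z - w‖) fun _ => hlog)]
  simp only [hlaw, Finset.prod_const, Finset.card_range, Pi.pow_apply]

theorem measure_norm_sum_polyValue_le [Fintype ι] [IsProbabilityMeasure P] (hX : IsSample P μ X)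
    {z : ℂ} {k : ι} (hz : IsRegularPoint (μ k) z) (δ : ι → ℕ) {s : ℝ} (hs : 0 < s) :
    P {ω | ‖∑ j, polyValue X z j (δ j) ω‖ ≤ s / 2} ≤
      P {ω | ‖polyValue X z k (δ k) ω‖ < s} + ENNReal.ofReal (exp 2⁻¹ *
        ∫ t, ‖charFun ((μ k).map fun w => log ‖z - w‖) t‖ ^ δ k ∂(gaussianReal 0 1)) := by
  classical
  let W : Ω → ℂ := fun ω => ∑ j ∈ Finset.univ.erase k, polyValue X z j (δ j) ω
  have hconc := measureReal_abs_sub_le_one_le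
    (hX.measurable_polyValue z k (δ k)).norm.log.aemeasurable
    (hX.measurable_sum_polyValue z (Finset.univ.erase k) δ).norm.log.aemeasurable
    ((hX.indepFun_polyValue_sum z (Finset.notMem_erase k _) δ).comp measurable_norm.log
      measurable_norm.log)
  simp_rw [hX.charFun_map_log_norm_polyValue hz, norm_pow] at hconc
  calc P {ω | ‖∑ j, polyValue X z j (δ j) ω‖ ≤ s / 2}
      ≤ P ({ω | ‖polyValue X z k (δ k) ω‖ < s} ∪
          {ω | |log ‖polyValue X z k (δ k) ω‖ - log ‖W ω‖| ≤ 1}) := by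
        refine measure_mono fun ω (hω : _ ≤ s / 2) => or_iff_not_imp_left.2 fun hlarge => ?_
        have hlarge : s ≤ ‖polyValue X z k (δ k) ω‖ := not_lt.1 hlarge
        rw [← Finset.add_sum_erase _ _ (Finset.mem_univ k)] at hω
        exact abs_log_norm_sub_log_norm_le_one (hs.trans_le hlarge)
          (hω.trans (div_le_div_of_nonneg_right hlarge zero_le_two))
    _ ≤ _ := by
        refine (measure_union_le _ _).trans (add_le_add le_rfl ?_)
        rw [← ofReal_measureReal]
        exact ENNReal.ofReal_le_ofReal hconc

end IsSample

end Sample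

section PointwiseConvergence

variable {ι Ω : Type*} [MeasurableSpace Ω] {P : Measure Ω} {μ : ι → Measure ℂ}
  {X : ℕ → ι → Ω → ℂ}

/-- The conditions on `z` under which the sums `∑ k, polyValue X z k (d k n)` are shown to have the
exponential growth rate `max_k c_k U_{μ_k}(z)`. -/
structure IsGoodPoint (P : Measure Ω) (μ : ι → Measure ℂ) (X : ℕ → ι → Ω → ℂ) (z : ℂ) :
    Prop where
  regular : ∀ k, IsRegularPoint (μ k) z
  norm_charFun_lt_one : ∀ k, NonDegenerate (μ k) →
    ∀ᵐ t ∂(gaussianReal 0 1), ‖charFun ((μ k).map fun w => log ‖z - w‖) t‖ < 1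
  sum_ne_zero : ∀ M : Finset ι, M.Nonempty → ∀ δ : ι → ℕ,
    ∀ᵐ ω ∂P, ∑ k ∈ M, polyValue X z k (δ k) ω ≠ 0

namespace IsSample

theorem ae_ae_sum_polyValue_ne_zero [SFinite P] (hX : IsSample P μ X) {M : Finset ι}
    (hM : M.Nonempty) (δ : ι → ℕ) :
    ∀ᵐ z : ℂ, ∀ᵐ ω ∂P, ∑ k ∈ M, polyValue X z k (δ k) ω ≠ 0 := by
  rw [Measure.ae_ae_comm]
  · refine ae_of_all _ fun ω => ?_
    filter_upwards [ae_eval_ne_zero (sum_rootPoly_ne_zero (fun k i => X i k ω) hM δ)] with z hz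
    rwa [eval_finsetSum] at hz
  · exact (measurableSet_eq_fun (Finset.measurable_fun_sum _ fun k _ =>
      hX.measurable_polyValue_uncurry k (δ k)) measurable_const).compl

theorem ae_isGoodPoint [Finite ι] [∀ k, IsProbabilityMeasure (μ k)] [SFinite P]
    (hX : IsSample P μ X) (hlog : ∀ k, HasLogMoment (μ k)) : ∀ᵐ z, IsGoodPoint P μ X z := by
  have := nullSingletonClass_gaussianReal (μ := 0) one_ne_zero
  have hchar : ∀ᵐ z : ℂ, ∀ k, NonDegenerate (μ k) →
      ∀ᵐ t ∂(gaussianReal 0 1), ‖charFun ((μ k).map fun w => log ‖z - w‖) t‖ < 1 :=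
    ae_all_iff.2 fun k => eventually_imp_distrib_left.2 fun hk => hk.ae_norm_charFun_lt_one _
  have hsum : ∀ᵐ z : ℂ, ∀ M : Finset ι, M.Nonempty → ∀ δ : ι → ℕ,
      ∀ᵐ ω ∂P, ∑ k ∈ M, polyValue X z k (δ k) ω ≠ 0 :=
    ae_all_iff.2 fun M => eventually_imp_distrib_left.2 fun hM => ae_all_iff.2 fun δ =>
      hX.ae_ae_sum_polyValue_ne_zero hM δ
  filter_upwards [ae_all_iff.2 fun k => (hlog k).ae_isRegularPoint, hchar, hsum]
    with z hz_regular hz_char hz_sum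
  exact ⟨hz_regular, hz_char, hz_sum⟩

variable [Fintype ι] [IsProbabilityMeasure P] {z : ℂ} {d : ι → ℕ → ℕ} {c : ι → ℝ} {b : ℝ}

theorem tendsto_measure_exp_le_norm_sum (hX : IsSample P μ X)
    (hz : ∀ k, IsRegularPoint (μ k) z)
    (hc : ∀ k, Tendsto (fun n : ℕ => (d k n : ℝ) / n) atTop (𝓝 (c k)))
    (hb : realMaxPotential c μ z < b) :
    Tendsto (fun n : ℕ => P {ω | exp (n * b) ≤ ‖∑ k, polyValue X z k (d k n) ω‖})
      atTop (𝓝 0) := by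
  refine tendsto_measure_zero_of_ae_eventually_notMem (fun n => measurableSet_le measurable_const
    (hX.measurable_sum_polyValue z _ _).norm) ?_
  filter_upwards [ae_all_iff.2 fun k => hX.ae_tendsto_log_norm_polyValue_div (hz k) (hc k)]
    with ω hω
  have hlim : Tendsto (fun n : ℕ => ∑ k, exp (-(n * b)) * ‖polyValue X z k (d k n) ω‖)
      atTop (𝓝 0) := by
    simpa only [Finset.sum_const_zero] using tendsto_finsetSum Finset.univ fun k _ =>
      tendsto_exp_mul_mul_nhds_zero (fun _ => norm_nonneg _) (hω k)
        ((mul_realPotential_le_realMaxPotential k z).trans_lt hb)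
  filter_upwards [hlim.eventually_lt_const one_pos] with n hn
  rw [← Finset.mul_sum, exp_neg, inv_mul_lt_iff₀ (exp_pos _), mul_one] at hn
  exact not_le.2 ((norm_sum_le _ _).trans_lt hn)

theorem tendsto_measure_norm_sum_le_exp_of_tendsto_atTop (hX : IsSample P μ X) {k : ι}
    (hz : IsRegularPoint (μ k) z)
    (hchar : ∀ᵐ t ∂(gaussianReal 0 1), ‖charFun ((μ k).map fun w => log ‖z - w‖) t‖ < 1)
    (hc : Tendsto (fun n : ℕ => (d k n : ℝ) / n) atTop (𝓝 (c k))) {g : Filter ℕ}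
    (hg : g ≤ atTop) (hd : Tendsto (d k) g atTop) (hb : b < c k * realPotential (μ k) z) :
    Tendsto (fun n : ℕ => P {ω | ‖∑ j, polyValue X z j (d j n) ω‖ ≤ exp (n * b)}) g (𝓝 0) := by
  obtain ⟨b', hbb', hb'⟩ := exists_between hb
  have hprob : IsProbabilityMeasure (μ k) :=
    hX.law 0 k ▸ Measure.isProbabilityMeasure_map (hX.measurable 0 k).aemeasurable
  have hsmall : Tendsto (fun n : ℕ => P {ω | ‖polyValue X z k (d k n) ω‖ < exp (n * b')})
      g (𝓝 0) := by
    refine Tendsto.mono_left (tendsto_measure_zero_of_ae_eventually_notMem (fun n =>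
      measurableSet_lt (hX.measurable_polyValue z k _).norm measurable_const) ?_) hg
    filter_upwards [hX.ae_tendsto_log_norm_polyValue_div hz hc,
      hX.ae_forall_polyValue_ne_zero hz] with ω hω hω_ne
    filter_upwards [eventually_exp_mul_le (fun n => norm_pos_iff.2 (hω_ne (d k n))) hω hb']
      with n hn
    exact not_lt.2 hn
  have hconc : Tendsto (fun n : ℕ => ENNReal.ofReal (exp 2⁻¹ *
      ∫ t, ‖charFun ((μ k).map fun w => log ‖z - w‖) t‖ ^ d k n ∂(gaussianReal 0 1))) g (𝓝 0) := by
    have hlim := (tendsto_integral_norm_pow_zero measurable_charFun.aestronglyMeasurable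
      hchar).comp hd
    simpa only [mul_zero, ENNReal.ofReal_zero, Function.comp_def] using
      ENNReal.tendsto_ofReal (hlim.const_mul _)
  have hgap : ∀ᶠ n : ℕ in g, exp (n * b) ≤ exp (n * b') / 2 := by
    filter_upwards [hg ((tendsto_exp_natCast_mul_nhds_zero (sub_neg.2 hbb')).eventually_le_const
      one_half_pos)] with n hn
    calc exp (n * b) = exp (n * b') * exp (n * (b - b')) := by
          rw [← exp_add]
          ring_nf
      _ ≤ exp (n * b') * (1 / 2) := by gcongr
      _ = exp (n * b') / 2 := by ring
  refine tendsto_of_tendsto_of_tendsto_of_le_of_le' tendsto_const_nhds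
    (by simpa only [add_zero] using hsmall.add hconc) (.of_forall fun _ => zero_le) ?_
  filter_upwards [hgap] with n hn
  exact (measure_mono fun ω hω => hω.trans hn).trans
    (hX.measure_norm_sum_polyValue_le hz (fun j => d j n) (exp_pos _))

theorem tendsto_measure_norm_sum_le_exp_of_eventually_eq (hX : IsSample P μ X)
    (hz : IsGoodPoint P μ X z)
    (hc : ∀ k, Tendsto (fun n : ℕ => (d k n : ℝ) / n) atTop (𝓝 (c k))) {M : Finset ι}
    (hM : M.Nonempty) (hneg : ∀ k ∉ M, c k * realPotential (μ k) z < 0) {g : Filter ℕ}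
    (hg : g ≤ atTop) {δ : ι → ℕ} (hδ : ∀ k ∈ M, ∀ᶠ n in g, d k n = δ k) (hb : b < 0) :
    Tendsto (fun n : ℕ => P {ω | ‖∑ k, polyValue X z k (d k n) ω‖ ≤ exp (n * b)}) g (𝓝 0) := by
  classical
  let S (n : ℕ) (ω : Ω) : ℂ :=
    ∑ k ∈ M, polyValue X z k (δ k) ω + ∑ k ∈ Mᶜ, polyValue X z k (d k n) ω
  have hlim : Tendsto (fun n : ℕ => P {ω | ‖S n ω‖ ≤ exp (n * b)}) atTop (𝓝 0) := by
    refine tendsto_measure_zero_of_ae_eventually_notMem (fun n => measurableSet_le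
      ((hX.measurable_sum_polyValue z _ _).add (hX.measurable_sum_polyValue z _ _)).norm
      measurable_const) ?_
    filter_upwards [hz.sum_ne_zero M hM δ, ae_all_iff.2 fun k =>
      hX.ae_tendsto_log_norm_polyValue_div (hz.regular k) (hc k)] with ω hω_ne hω
    have hrest : Tendsto (fun n => ∑ k ∈ Mᶜ, polyValue X z k (d k n) ω) atTop (𝓝 0) := by
      rw [← Finset.sum_const_zero (s := Mᶜ)]
      refine tendsto_finsetSum _ fun k hk => ?_
      refine tendsto_zero_iff_norm_tendsto_zero.2 ?_
      simpa only [mul_zero, neg_zero, exp_zero, one_mul] using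
        tendsto_exp_mul_mul_nhds_zero (fun _ => norm_nonneg _) (hω k)
          (hneg k (Finset.mem_compl.1 hk))
    have hS := (hrest.const_add (∑ k ∈ M, polyValue X z k (δ k) ω)).norm
    rw [add_zero] at hS
    filter_upwards [(tendsto_exp_natCast_mul_nhds_zero hb).eventually_lt hS
      (norm_pos_iff.2 hω_ne)] with n hn
    exact not_le.2 hn
  refine (hlim.mono_left hg).congr' ?_
  filter_upwards [(eventually_all_finset M).2 hδ] with n hn
  have hsum (ω : Ω) : S n ω = ∑ k, polyValue X z k (d k n) ω := by
    rw [← Finset.sum_add_sum_compl M]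
    exact congrArg (· + _) (Finset.sum_congr rfl fun k hk => by rw [hn k hk])
  simp_rw [hsum]

/- Along an ultrafilter every `d k` either tends to infinity or is eventually constant. If a term
with the maximal exponent has degree tending to infinity, then its modulus is anti-concentrated and
cannot be cancelled by the other terms; otherwise the maximum is `0`, and the terms attaining it
form a fixed random variable that almost surely does not vanish. -/
theorem tendsto_measure_norm_sum_le_exp [Nonempty ι] (hX : IsSample P μ X)
    (hz : IsGoodPoint P μ X z)
    (hc : ∀ k, Tendsto (fun n : ℕ => (d k n : ℝ) / n) atTop (𝓝 (c k)))
    (hnondeg : ∀ k, ¬ BddAbove (Set.range (d k)) → NonDegenerate (μ k))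
    (hb : b < realMaxPotential c μ z) :
    Tendsto (fun n : ℕ => P {ω | ‖∑ k, polyValue X z k (d k n) ω‖ ≤ exp (n * b)})
      atTop (𝓝 0) := by
  classical
  refine (tendsto_iff_ultrafilter _ _ _).2 fun g hg => ?_
  obtain ⟨k₀, hk₀⟩ := exists_realMaxPotential_eq c μ z
  by_cases htop : ∃ k, c k * realPotential (μ k) z = realMaxPotential c μ z ∧
    Tendsto (d k) g atTop
  · obtain ⟨k, hk, hdk⟩ := htop
    have hunbdd : ¬ BddAbove (Set.range (d k)) := fun ⟨B, hB⟩ =>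
      have ⟨n, hn⟩ := (hdk.eventually_gt_atTop B).exists
      (hB ⟨n, rfl⟩).not_gt hn
    exact hX.tendsto_measure_norm_sum_le_exp_of_tendsto_atTop (hz.regular k)
      (hz.norm_charFun_lt_one k (hnondeg k hunbdd)) (hc k) hg hdk (hb.trans_eq hk.symm)
  · push Not at htop
    have hconst (k : ι) : ∃ N, c k * realPotential (μ k) z = realMaxPotential c μ z →
        ∀ᶠ n in g, d k n = N := by
      by_cases hk : c k * realPotential (μ k) z = realMaxPotential c μ z
      · obtain ⟨N, hN⟩ :=
          (tendsto_atTop_or_exists_eventually_eq g (d k)).resolve_left (htop k hk)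
        exact ⟨N, fun _ => hN⟩
      · exact ⟨0, fun h => absurd h hk⟩
    choose δ hδ using hconst
    have hmax_zero : realMaxPotential c μ z = 0 := by
      rw [hk₀, eq_zero_of_tendsto_div_of_eventually_eq hg ((hc k₀).mono_left hg) (hδ k₀ hk₀.symm),
        zero_mul]
    rw [hmax_zero] at hδ hb
    refine hX.tendsto_measure_norm_sum_le_exp_of_eventually_eq hz hc
      (M := Finset.univ.filter fun k => c k * realPotential (μ k) z = 0)
      ⟨k₀, Finset.mem_filter.2 ⟨Finset.mem_univ _, hk₀.symm.trans hmax_zero⟩⟩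
      (fun k hk => ?_) hg (δ := δ) (fun k hk => ?_) hb
    · have hne : c k * realPotential (μ k) z ≠ 0 :=
        fun h => hk (Finset.mem_filter.2 ⟨Finset.mem_univ _, h⟩)
      exact ((mul_realPotential_le_realMaxPotential k z).trans_eq hmax_zero).lt_of_ne hne
    · exact hδ k (Finset.mem_filter.1 hk).2

theorem tendstoInMeasure_inv_mul_log_norm_sum [Nonempty ι] (hX : IsSample P μ X)
    (hz : IsGoodPoint P μ X z)
    (hc : ∀ k, Tendsto (fun n : ℕ => (d k n : ℝ) / n) atTop (𝓝 (c k)))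
    (hnondeg : ∀ k, ¬ BddAbove (Set.range (d k)) → NonDegenerate (μ k)) :
    TendstoInMeasure P (fun (n : ℕ) ω => (n : ℝ)⁻¹ * log ‖∑ k, polyValue X z k (d k n) ω‖) atTop
      fun _ => realMaxPotential c μ z := by
  refine tendstoInMeasure_iff_norm.2 fun ε hε => ?_
  have hlim := (hX.tendsto_measure_norm_sum_le_exp hz hc hnondeg (sub_lt_self _ hε)).add
    (hX.tendsto_measure_exp_le_norm_sum hz.regular hc (lt_add_of_pos_right _ hε))
  rw [add_zero] at hlim
  refine tendsto_of_tendsto_of_tendsto_of_le_of_le' tendsto_const_nhds hlim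
    (.of_forall fun _ => zero_le) ?_
  filter_upwards [eventually_gt_atTop 0] with n hn
  have hn : (0 : ℝ) < n := Nat.cast_pos.2 hn
  refine (measure_mono fun ω hω => ?_).trans (measure_union_le _ _)
  by_contra h
  obtain ⟨hlower, hupper⟩ := not_or.1 h
  have hlower : exp (n * (realMaxPotential c μ z - ε)) < ‖∑ k, polyValue X z k (d k n) ω‖ :=
    not_le.1 hlower
  have hupper : ‖∑ k, polyValue X z k (d k n) ω‖ < exp (n * (realMaxPotential c μ z + ε)) :=
    not_le.1 hupper
  have hpos := (exp_pos _).trans hlower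
  rw [← lt_log_iff_exp_lt hpos, ← lt_inv_mul_iff₀ hn] at hlower
  rw [← log_lt_iff_lt_exp hpos, ← inv_mul_lt_iff₀ hn] at hupper
  have hclose :
      |(n : ℝ)⁻¹ * log ‖∑ k, polyValue X z k (d k n) ω‖ - realMaxPotential c μ z| < ε :=
    abs_sub_lt_iff.2 ⟨by linarith, by linarith⟩
  exact hclose.not_ge hω

end IsSample

end PointwiseConvergence

section IntegratedConvergence

/-- Boundedness in probability, i.e. tightness, of a sequence of `[0, ∞]`-valued random variables.
It is used for the logarithmic moments of the zeros and for `L²` norms on balls. -/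
def BoundedInProbability {Ω : Type*} [MeasurableSpace Ω] (P : Measure Ω) (g : ℕ → Ω → ℝ≥0∞) :
    Prop :=
  ∀ η : ℝ≥0∞, 0 < η → ∃ C : ℝ≥0∞, C ≠ ∞ ∧ ∀ᶠ n in atTop, P {ω | C < g n ω} ≤ η

variable {S Ω E : Type*} [MeasurableSpace S] [MeasurableSpace Ω] {P : Measure Ω} {ν : Measure S}
  [NormedAddCommGroup E] {f : ℕ → S → Ω → E} {u : S → E}

theorem lintegral_enorm_le_mul_add_eLpNorm_mul {g : S → E} (hg : AEStronglyMeasurable g ν)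
    (δ : ℝ≥0∞) :
    ∫⁻ z, ‖g z‖ₑ ∂ν ≤ δ * ν Set.univ + eLpNorm g 2 ν * ν {z | δ ≤ ‖g z‖ₑ} ^ (2⁻¹ : ℝ) := by
  set s := {z | δ ≤ ‖g z‖ₑ}
  have hsplit (z : S) : ‖g z‖ₑ ≤ δ + s.indicator (fun z => ‖g z‖ₑ) z := by
    by_cases hz : z ∈ s
    · rw [Set.indicator_of_mem hz]
      exact le_add_self
    · exact (not_le.1 hz).le.trans le_self_add
  have hholder : ∫⁻ z in s, ‖g z‖ₑ ∂ν ≤ eLpNorm g 2 ν * ν s ^ (2⁻¹ : ℝ) := by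
    have h := eLpNorm_le_eLpNorm_mul_rpow_measure_univ one_le_two hg.restrict (μ := ν.restrict s)
    rw [eLpNorm_one_eq_lintegral_enorm, Measure.restrict_apply_univ] at h
    have hexp : 1 / ENNReal.toReal 1 - 1 / ENNReal.toReal 2 = 2⁻¹ := by norm_num
    rw [hexp] at h
    exact h.trans (mul_le_mul_left (eLpNorm_mono_measure g Measure.restrict_le_self) _)
  calc ∫⁻ z, ‖g z‖ₑ ∂ν ≤ ∫⁻ z, δ + s.indicator (fun z => ‖g z‖ₑ) z ∂ν := lintegral_mono hsplit
    _ ≤ δ * ν Set.univ + ∫⁻ z in s, ‖g z‖ₑ ∂ν := by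
        rw [lintegral_add_left measurable_const, lintegral_const]
        exact add_le_add le_rfl (lintegral_indicator_le _ _)
    _ ≤ _ := add_le_add le_rfl hholder

variable [MeasurableSpace E] [BorelSpace E] [SecondCountableTopology E] [IsFiniteMeasure P]
  [IsFiniteMeasure ν]

theorem tendstoInMeasure_prod_of_ae (hf : ∀ n, Measurable fun p : S × Ω => f n p.1 p.2)
    (hu : Measurable u) (h : ∀ᵐ z ∂ν, TendstoInMeasure P (fun n ω => f n z ω) atTop fun _ => u z) :
    TendstoInMeasure (ν.prod P) (fun n p => f n p.1 p.2) atTop fun p => u p.1 := by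
  intro δ hδ
  have hmeas (n : ℕ) : MeasurableSet {p : S × Ω | δ ≤ edist (f n p.1 p.2) (u p.1)} :=
    measurableSet_le measurable_const ((hf n).edist (hu.comp measurable_fst))
  simp_rw [Measure.prod_apply (hmeas _)]
  rw [← lintegral_zero (μ := ν)]
  refine tendsto_lintegral_of_dominated_convergence (fun _ => P Set.univ)
    (fun n => measurable_measure_prodMk_left (hmeas n))
    (fun n => ae_of_all _ fun z => measure_mono (Set.subset_univ _)) ?_ (h.mono fun z hz => hz δ hδ)
  rw [lintegral_const]
  finiteness

theorem tendsto_measure_le_measure_le_enorm_sub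
    (hf : ∀ n, Measurable fun p : S × Ω => f n p.1 p.2) (hu : Measurable u)
    (h : ∀ᵐ z ∂ν, TendstoInMeasure P (fun n ω => f n z ω) atTop fun _ => u z) {δ : ℝ≥0∞}
    (hδ : 0 < δ) (hδ_top : δ ≠ ∞) :
    Tendsto (fun n => P {ω | δ ≤ ν {z | δ ≤ ‖f n z ω - u z‖ₑ}}) atTop (𝓝 0) := by
  let A (n : ℕ) : Set (S × Ω) := {p | δ ≤ edist (f n p.1 p.2) (u p.1)}
  have hA (n : ℕ) : MeasurableSet (A n) :=
    measurableSet_le measurable_const ((hf n).edist (hu.comp measurable_fst))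
  have hmarkov (n : ℕ) : P {ω | δ ≤ ν ((fun z => (z, ω)) ⁻¹' A n)} ≤ ν.prod P (A n) / δ := by
    rw [Measure.prod_apply_symm (hA n)]
    exact meas_ge_le_lintegral_div (measurable_measure_prodMk_right (hA n)).aemeasurable
      hδ.ne' hδ_top
  have hlim : Tendsto (fun n => ν.prod P (A n) / δ) atTop (𝓝 0) := by
    simpa only [ENNReal.zero_div] using
      ENNReal.Tendsto.div_const (tendstoInMeasure_prod_of_ae hf hu h δ hδ) (Or.inr hδ.ne')
  simp_rw [← edist_eq_enorm_sub]
  exact tendsto_of_tendsto_of_tendsto_of_le_of_le tendsto_const_nhds hlim (fun _ => zero_le) hmarkov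

theorem tendsto_measure_le_lintegral_enorm_sub (hf : ∀ n, Measurable fun p : S × Ω => f n p.1 p.2)
    (hu : Measurable u) (h : ∀ᵐ z ∂ν, TendstoInMeasure P (fun n ω => f n z ω) atTop fun _ => u z)
    (hbdd : BoundedInProbability P fun n ω => eLpNorm (fun z => f n z ω - u z) 2 ν)
    {ε : ℝ≥0∞} (hε : 0 < ε) :
    Tendsto (fun n => P {ω | ε ≤ ∫⁻ z, ‖f n z ω - u z‖ₑ ∂ν}) atTop (𝓝 0) := by
  refine ENNReal.tendsto_nhds_zero.2 fun η hη => ?_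
  obtain ⟨C, hC, hCn⟩ := hbdd (η / 2) (ENNReal.half_pos hη.ne')
  obtain ⟨δ, hδε, hδ, hδ_top⟩ :
      ∃ δ : ℝ≥0∞, δ * ν Set.univ + C * δ ^ (2⁻¹ : ℝ) < ε ∧ δ ∈ Set.Ioo 0 ∞ := by
    have hcont : Continuous fun δ : ℝ≥0∞ => δ * ν Set.univ + C * δ ^ (2⁻¹ : ℝ) :=
      (ENNReal.continuous_mul_const (measure_ne_top _ _)).add
        ((ENNReal.continuous_const_mul hC).comp ENNReal.continuous_rpow_const)
    have hlim := (hcont.tendsto 0).mono_left (nhdsWithin_le_nhds (s := Set.Ioi 0))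
    simp only [zero_mul, ENNReal.zero_rpow_of_pos (inv_pos.2 (two_pos (α := ℝ))), mul_zero,
      add_zero] at hlim
    exact ((hlim.eventually_lt_const hε).and (Ioo_mem_nhdsGT ENNReal.zero_lt_top)).exists
  filter_upwards [hCn, ENNReal.tendsto_nhds_zero.1 (tendsto_measure_le_measure_le_enorm_sub hf hu h
    hδ hδ_top.ne) _ (ENNReal.half_pos hη.ne')] with n hn hn'
  have hsub : {ω | ε ≤ ∫⁻ z, ‖f n z ω - u z‖ₑ ∂ν} ⊆
      {ω | C < eLpNorm (fun z => f n z ω - u z) 2 ν} ∪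
        {ω | δ ≤ ν {z | δ ≤ ‖f n z ω - u z‖ₑ}} := by
    intro ω hω
    by_contra hcon
    obtain ⟨hnorm, hslice⟩ := not_or.1 hcon
    have hmeas : AEStronglyMeasurable (fun z => f n z ω - u z) ν :=
      (((hf n).comp measurable_prodMk_right).sub hu).aestronglyMeasurable
    refine (hδε.trans_le hω).not_ge ((lintegral_enorm_le_mul_add_eLpNorm_mul hmeas δ).trans ?_)
    gcongr
    · exact not_lt.1 hnorm
    · exact (not_le.1 hslice).le
  exact (measure_mono hsub).trans ((measure_union_le _ _).trans
    ((add_le_add hn hn').trans_eq (ENNReal.add_halves η)))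

theorem tendstoInMeasure_integral_smul {F : Type*} [NormedAddCommGroup F] [NormedSpace ℝ F]
    {f : ℕ → S → Ω → ℝ} {u : S → ℝ} (hf : ∀ n, Measurable fun p : S × Ω => f n p.1 p.2)
    (hu : Measurable u) (h : ∀ᵐ z ∂ν, TendstoInMeasure P (fun n ω => f n z ω) atTop fun _ => u z)
    (hbdd : BoundedInProbability P fun n ω => eLpNorm (fun z => f n z ω - u z) 2 ν)
    (hf_int : ∀ᶠ n in atTop, ∀ ω, Integrable (fun z => f n z ω) ν) (hu_int : Integrable u ν)
    {v : S → F} (hv : AEStronglyMeasurable v ν) {K : ℝ} (hK : ∀ z, ‖v z‖ ≤ K) :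
    TendstoInMeasure P (fun n ω => ∫ z, f n z ω • v z ∂ν) atTop fun _ => ∫ z, u z • v z ∂ν := by
  intro ε hε
  refine tendsto_of_tendsto_of_tendsto_of_le_of_le' tendsto_const_nhds
    (tendsto_measure_le_lintegral_enorm_sub hf hu h hbdd
      (ENNReal.div_pos hε.ne' (ENNReal.ofReal_ne_top (r := K)))) (.of_forall fun _ => zero_le) ?_
  filter_upwards [hf_int] with n hn
  have hu' : Integrable (fun z => u z • v z) ν := hu_int.smul_bdd K hv (ae_of_all _ hK)
  refine measure_mono fun ω hω => ?_
  have hf' : Integrable (fun z => f n z ω • v z) ν := (hn ω).smul_bdd K hv (ae_of_all _ hK)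
  refine ENNReal.div_le_of_le_mul (le_trans hω ?_)
  calc edist (∫ z, f n z ω • v z ∂ν) (∫ z, u z • v z ∂ν)
      = ‖∫ z, (f n z ω - u z) • v z ∂ν‖ₑ := by
        simp_rw [edist_eq_enorm_sub, sub_smul, integral_sub hf' hu']
    _ ≤ ∫⁻ z, ‖f n z ω - u z‖ₑ * ‖v z‖ₑ ∂ν := by
        refine (enorm_integral_le_lintegral_enorm _).trans_eq ?_
        simp_rw [enorm_smul]
    _ ≤ ∫⁻ z, ‖f n z ω - u z‖ₑ * ENNReal.ofReal K ∂ν := by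
        gcongr with z
        rw [← ofReal_norm]
        exact ENNReal.ofReal_le_ofReal (hK z)
    _ = (∫⁻ z, ‖f n z ω - u z‖ₑ ∂ν) * ENNReal.ofReal K :=
        lintegral_mul_const' _ _ ENNReal.ofReal_ne_top

theorem tendstoInMeasure_integral_smul_of_hasCompactSupport {S F : Type*} [NormedAddCommGroup S]
    [ProperSpace S] [MeasurableSpace S] [BorelSpace S] {ν : Measure S}
    [IsFiniteMeasureOnCompacts ν] [NormedAddCommGroup F] [NormedSpace ℝ F]
    {f : ℕ → S → Ω → ℝ} {u : S → ℝ} (hf : ∀ n, Measurable fun p : S × Ω => f n p.1 p.2)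
    (hu : Measurable u) (h : ∀ᵐ z ∂ν, TendstoInMeasure P (fun n ω => f n z ω) atTop fun _ => u z)
    (hbdd : ∀ R : ℝ, BoundedInProbability P fun n ω =>
      eLpNorm (fun z => f n z ω - u z) 2 (ν.restrict (closedBall 0 R)))
    (hf_int : ∀ᶠ n in atTop, ∀ ω, LocallyIntegrable (fun z => f n z ω) ν)
    (hu_int : LocallyIntegrable u ν) {v : S → F} (hv : Continuous v) (hvc : HasCompactSupport v) :
    TendstoInMeasure P (fun n ω => ∫ z, f n z ω • v z ∂ν) atTop fun _ => ∫ z, u z • v z ∂ν := by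
  obtain ⟨R, hR⟩ := hvc.isCompact.isBounded.subset_closedBall (0 : S)
  obtain ⟨K, hK⟩ := hvc.exists_bound_of_continuous hv
  have : IsFiniteMeasure (ν.restrict (closedBall (0 : S) R)) :=
    isFiniteMeasure_restrict.2 measure_closedBall_lt_top.ne
  have hball (g : S → ℝ) : ∫ z in closedBall 0 R, g z • v z ∂ν = ∫ z, g z • v z ∂ν :=
    setIntegral_eq_integral_of_forall_compl_eq_zero fun z hz => by
      rw [image_eq_zero_of_notMem_tsupport fun h => hz (hR h), smul_zero]
  simp_rw [← hball]
  exact tendstoInMeasure_integral_smul hf hu (ae_restrict_of_ae h) (hbdd R)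
    (hf_int.mono fun n hn ω => (hn ω).integrableOn_isCompact (isCompact_closedBall 0 R))
    (hu_int.integrableOn_isCompact (isCompact_closedBall 0 R)) hv.aestronglyMeasurable hK

end IntegratedConvergence

section LogPotentialOfRoots

theorem hasLogMoment_empiricalRootMeasure {n : ℕ} (hn : n ≠ 0) (p : ℂ[X]) :
    HasLogMoment (empiricalRootMeasure n p) :=
  integrable_empiricalRootMeasure hn p _

theorem exists_eLpNorm_inv_mul_log_norm_eval_le (R : ℝ) : ∃ A : ℝ≥0∞, A ≠ ∞ ∧
    ∀ {n : ℕ}, n ≠ 0 → ∀ {p : ℂ[X]}, p.natDegree = n →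
      eLpNorm (fun z => (n : ℝ)⁻¹ * log ‖p.eval z‖) 2 (volume.restrict (closedBall 0 R)) ≤
        A * (‖(n : ℝ)⁻¹ * log ‖p.leadingCoeff‖‖ₑ + (1 + logMoment (empiricalRootMeasure n p))) := by
  obtain ⟨A, hA, hle⟩ := exists_eLpNorm_absPotential_le R
  set V := volume (closedBall (0 : ℂ) R) ^ (2⁻¹ : ℝ)
  have hV : V ≠ ∞ := ENNReal.rpow_ne_top_of_nonneg (by norm_num) measure_closedBall_lt_top.ne
  refine ⟨V + A, ENNReal.add_ne_top.2 ⟨hV, hA⟩, fun {n} hn {p} hp => ?_⟩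
  set κ := empiricalRootMeasure n p
  set a := (n : ℝ)⁻¹ * log ‖p.leadingCoeff‖
  have : IsProbabilityMeasure κ := isProbabilityMeasure_empiricalRootMeasure hn hp
  have hp_ne : p ≠ 0 := fun h => hn (by rw [← hp, h, natDegree_zero])
  calc eLpNorm (fun z => (n : ℝ)⁻¹ * log ‖p.eval z‖) 2 (volume.restrict (closedBall 0 R))
      = eLpNorm (fun z => a + realPotential κ z) 2 (volume.restrict (closedBall 0 R)) :=
        eLpNorm_congr_ae (ae_restrict_of_ae (ae_inv_mul_log_norm_eval_eq n hp_ne))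
    _ ≤ eLpNorm (fun _ : ℂ => a) 2 (volume.restrict (closedBall 0 R)) +
          eLpNorm (absPotential κ) 2 (volume.restrict (closedBall 0 R)) :=
        (eLpNorm_add_le aestronglyMeasurable_const
          (measurable_realPotential κ).aestronglyMeasurable one_le_two).trans
          (add_le_add le_rfl (eLpNorm_mono_enorm (enorm_realPotential_le κ)))
    _ ≤ ‖a‖ₑ * V + A * (1 + logMoment κ) := by
        gcongr
        · rw [eLpNorm_const' a two_ne_zero ENNReal.ofNat_ne_top, Measure.restrict_apply_univ]
          norm_num [V]
        · exact hle κ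
    _ ≤ (V + A) * (‖a‖ₑ + (1 + logMoment κ)) := by
        rw [mul_comm ‖a‖ₑ, add_mul]
        exact add_le_add (mul_le_mul_right le_self_add V) (mul_le_mul_right le_add_self A)

theorem memLp_inv_mul_log_norm_eval {n : ℕ} (hn : n ≠ 0) {p : ℂ[X]} (hp : p.natDegree = n)
    (R : ℝ) :
    MemLp (fun z => (n : ℝ)⁻¹ * log ‖p.eval z‖) 2 (volume.restrict (closedBall 0 R)) := by
  obtain ⟨A, hA, hle⟩ := exists_eLpNorm_inv_mul_log_norm_eval_le R
  refine ⟨(p.continuous.measurable.norm.log.const_mul _).aestronglyMeasurable,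
    (hle hn hp).trans_lt (ENNReal.mul_lt_top hA.lt_top ?_)⟩
  have := (hasLogMoment_empiricalRootMeasure hn p).logMoment_lt_top
  finiteness

theorem integral_empiricalRootMeasure_eq_integral_laplacian {n : ℕ} (hn : n ≠ 0) {p : ℂ[X]}
    (hp : p.natDegree = n) {F : Type*} [NormedAddCommGroup F] [NormedSpace ℝ F] [CompleteSpace F]
    {φ : ℂ → F} (hφ : ContDiff ℝ 2 φ) (hc : HasCompactSupport φ) :
    ∫ w, φ w ∂(empiricalRootMeasure n p) =
      (2 * π)⁻¹ • ∫ z, ((n : ℝ)⁻¹ * log ‖p.eval z‖) • (Δ φ) z := by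
  have hκ := hasLogMoment_empiricalRootMeasure hn p
  have := isProbabilityMeasure_empiricalRootMeasure hn hp
  have hp_ne : p ≠ 0 := fun h => hn (by rw [← hp, h, natDegree_zero])
  have hΔ := continuous_laplacian hφ
  have hΔc := hasCompactSupport_laplacian hc
  have hsplit : (fun z => ((n : ℝ)⁻¹ * log ‖p.eval z‖) • (Δ φ) z) =ᵐ[volume] fun z =>
      ((n : ℝ)⁻¹ * log ‖p.leadingCoeff‖) • (Δ φ) z +
        realPotential (empiricalRootMeasure n p) z • (Δ φ) z := by
    filter_upwards [ae_inv_mul_log_norm_eval_eq n hp_ne] with z hz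
    rw [hz, add_smul]
  have hpot : Integrable (fun z => realPotential (empiricalRootMeasure n p) z • (Δ φ) z) :=
    (locallyIntegrable_of_memLp_closedBall one_le_two
      hκ.memLp_realPotential).integrable_smul_right_of_hasCompactSupport hΔ hΔc
  have hlead : Integrable (fun z => ((n : ℝ)⁻¹ * log ‖p.leadingCoeff‖) • (Δ φ) z) :=
    (hΔ.integrable_of_hasCompactSupport hΔc).smul _
  rw [integral_congr_ae hsplit, integral_add hlead hpot, integral_smul,
    integral_laplacian_eq_zero hφ hc, smul_zero, zero_add,
    hκ.integral_eq_integral_realPotential_smul_laplacian hφ hc]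

end LogPotentialOfRoots

section RandomPolynomial

theorem exists_nat_forall_measure_ge_le {α : Type*} [MeasurableSpace α] {B η : ℝ≥0∞} (hB : B ≠ ∞)
    (hη : 0 < η) : ∃ N : ℕ, ∀ (κ : Measure α) {g : α → ℝ≥0∞}, AEMeasurable g κ →
      ∫⁻ a, g a ∂κ ≤ B → κ {a | (N : ℝ≥0∞) ≤ g a} ≤ η := by
  obtain ⟨N, hN⟩ := ENNReal.exists_nat_mul_gt hη.ne' hB
  have hN_ne : (N : ℝ≥0∞) ≠ 0 := by
    intro h
    rw [h, zero_mul] at hN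
    exact not_lt_zero hN
  refine ⟨N, fun κ g hg hgB => ?_⟩
  refine (meas_ge_le_lintegral_div hg hN_ne (ENNReal.natCast_ne_top N)).trans ?_
  exact ENNReal.div_le_of_le_mul' (hgB.trans hN.le)

variable {ι Ω : Type*} [Fintype ι]

/-- The random polynomial `∑ k, p_{δ k, k}` whose zeros are studied. -/
def samplePoly (X : ℕ → ι → Ω → ℂ) (δ : ι → ℕ) (ω : Ω) : ℂ[X] :=
  ∑ k, rootPoly (fun i => X i k ω) (δ k)

theorem eval_samplePoly (X : ℕ → ι → Ω → ℂ) (δ : ι → ℕ) (ω : Ω) (z : ℂ) :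
    (samplePoly X δ ω).eval z = ∑ k, polyValue X z k (δ k) ω :=
  eval_finsetSum _ _ _

theorem natDegree_samplePoly (X : ℕ → ι → Ω → ℂ) {δ : ι → ℕ} {n : ℕ} (hle : ∀ k, δ k ≤ n)
    (hmax : ∃ k, δ k = n) (ω : Ω) : (samplePoly X δ ω).natDegree = n :=
  natDegree_sum_rootPoly _ (fun k _ => hle k) (hmax.imp fun k hk => ⟨Finset.mem_univ k, hk⟩)

theorem enorm_inv_mul_log_norm_leadingCoeff_samplePoly_le (X : ℕ → ι → Ω → ℂ) {δ : ι → ℕ} {n : ℕ}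
    (hle : ∀ k, δ k ≤ n) (hmax : ∃ k, δ k = n) (ω : Ω) :
    ‖(n : ℝ)⁻¹ * log ‖(samplePoly X δ ω).leadingCoeff‖‖ₑ ≤ ‖log (Fintype.card ι)‖ₑ := by
  obtain ⟨hlower, hupper⟩ : ‖(samplePoly X δ ω).leadingCoeff‖ ∈ Set.Icc (1 : ℝ) (Fintype.card ι) :=
    norm_leadingCoeff_sum_rootPoly_mem_Icc _ (fun k _ => hle k)
      (hmax.imp fun k hk => ⟨Finset.mem_univ k, hk⟩)
  have hlog := log_nonneg hlower
  rw [enorm_le_iff_norm_le, norm_of_nonneg (by positivity),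
    norm_of_nonneg (log_nonneg (hlower.trans hupper))]
  exact (mul_le_of_le_one_left hlog (Nat.cast_inv_le_one n)).trans
    (log_le_log (one_pos.trans_le hlower) hupper)

namespace IsSample

variable [MeasurableSpace Ω] {P : Measure Ω} {μ : ι → Measure ℂ} {X : ℕ → ι → Ω → ℂ}

theorem measurable_averageLogSize (hX : IsSample P μ X) (n : ℕ) :
    Measurable fun ω => averageLogSize (fun k i => X i k ω) n :=
  (Finset.measurable_fun_sum _ fun k _ => Finset.measurable_fun_sum _ fun i _ =>
    continuous_posLog.measurable.comp (hX.measurable i k).norm).const_mul _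

theorem lintegral_enorm_averageLogSize_le (hX : IsSample P μ X) (n : ℕ) :
    ∫⁻ ω, ‖averageLogSize (fun k i => X i k ω) n‖ₑ ∂P ≤ ∑ k, logMoment (μ k) := by
  have hmeas (i : ℕ) (k : ι) : Measurable fun ω => ‖log⁺ ‖X i k ω‖‖ₑ :=
    (continuous_posLog.measurable.comp (hX.measurable i k).norm).enorm
  have hmoment (i : ℕ) (k : ι) : ∫⁻ ω, ‖log⁺ ‖X i k ω‖‖ₑ ∂P = logMoment (μ k) := by
    rw [logMoment, ← hX.law i k, lintegral_map (f := fun w => ‖log⁺ ‖w‖‖ₑ)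
      (continuous_posLog.measurable.comp measurable_norm).enorm (hX.measurable i k)]
  calc ∫⁻ ω, ‖averageLogSize (fun k i => X i k ω) n‖ₑ ∂P
      ≤ ∫⁻ ω, ‖(n : ℝ)⁻¹‖ₑ * ∑ k, ∑ i ∈ Finset.range n, ‖log⁺ ‖X i k ω‖‖ₑ ∂P := by
        gcongr with ω
        rw [averageLogSize, enorm_mul]
        gcongr
        exact (enorm_sum_le _ _).trans (Finset.sum_le_sum fun k _ => enorm_sum_le _ _)
    _ = ‖(n : ℝ)⁻¹‖ₑ * ‖(n : ℝ)‖ₑ * ∑ k, logMoment (μ k) := by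
        rw [lintegral_const_mul _ (by fun_prop), lintegral_finsetSum _ (by fun_prop)]
        simp_rw [lintegral_finsetSum _ fun i _ => hmeas i _, hmoment, Finset.sum_const,
          Finset.card_range, nsmul_eq_mul, enorm_natCast]
        rw [← Finset.mul_sum, mul_assoc]
    _ ≤ 1 * ∑ k, logMoment (μ k) := by
        gcongr
        rw [← enorm_mul, ← enorm_one (G := ℝ), enorm_le_iff_norm_le, norm_one,
          norm_of_nonneg (by positivity)]
        exact inv_mul_le_one
    _ = _ := one_mul _

variable {d : ι → ℕ → ℕ}

theorem boundedInProbability_logMoment (hX : IsSample P μ X) (hlog : ∀ k, HasLogMoment (μ k))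
    (hdeg : ∀ᶠ n in atTop, (∀ k, d k n ≤ n) ∧ ∃ k, d k n = n) :
    BoundedInProbability P fun n ω =>
      logMoment (empiricalRootMeasure n (samplePoly X (fun k => d k n) ω)) := by
  intro η hη
  have hB : ∑ k, logMoment (μ k) ≠ ∞ :=
    (ENNReal.sum_lt_top.2 fun k _ => (hlog k).logMoment_lt_top).ne
  obtain ⟨N, hN⟩ := exists_nat_forall_measure_ge_le (α := Ω) hB hη
  refine ⟨ENNReal.ofReal (log (Fintype.card ι) + log 2) + N, by finiteness, ?_⟩
  filter_upwards [hdeg, eventually_ne_atTop 0] with n hn hn_ne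
  refine (measure_mono fun ω hω => ?_).trans (hN P
    (hX.measurable_averageLogSize n).enorm.aemeasurable (hX.lintegral_enorm_averageLogSize_le n))
  have hbound := (lt_of_lt_of_le hω (logMoment_empiricalRootMeasure_sum_rootPoly_le
    (fun k i => X i k ω) hn_ne hn.1 hn.2)).trans_le ENNReal.ofReal_add_le
  exact ((ENNReal.add_lt_add_iff_left ENNReal.ofReal_ne_top).1 hbound).le.trans
    (Real.ofReal_le_enorm _)

theorem boundedInProbability_eLpNorm_sub (hX : IsSample P μ X) (hlog : ∀ k, HasLogMoment (μ k))
    (hdeg : ∀ᶠ n in atTop, (∀ k, d k n ≤ n) ∧ ∃ k, d k n = n) {R : ℝ} {u : ℂ → ℝ}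
    (hu : MemLp u 2 (volume.restrict (closedBall 0 R))) :
    BoundedInProbability P fun n ω =>
      eLpNorm (fun z => (n : ℝ)⁻¹ * log ‖∑ k, polyValue X z k (d k n) ω‖ - u z) 2
        (volume.restrict (closedBall 0 R)) := by
  intro η hη
  obtain ⟨M, hM, hP⟩ := hX.boundedInProbability_logMoment hlog hdeg η hη
  obtain ⟨A, hA, hnorm⟩ := exists_eLpNorm_inv_mul_log_norm_eval_le R
  have hu_top := hu.eLpNorm_ne_top
  refine ⟨A * (‖log (Fintype.card ι)‖ₑ + (1 + M)) +
    eLpNorm u 2 (volume.restrict (closedBall 0 R)), by finiteness, ?_⟩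
  filter_upwards [hdeg, hP, eventually_ne_atTop 0] with n hn hPn hn_ne
  refine (measure_mono fun ω hω => ?_).trans hPn
  by_contra hcon
  refine (show (_ : ℝ≥0∞) < _ from hω).not_ge ?_
  have hdegree := natDegree_samplePoly X hn.1 hn.2 ω
  simp_rw [← eval_samplePoly]
  refine (eLpNorm_sub_le (memLp_inv_mul_log_norm_eval hn_ne hdegree R).1 hu.1 one_le_two).trans ?_
  refine add_le_add ((hnorm hn_ne hdegree).trans ?_) le_rfl
  gcongr
  · exact enorm_inv_mul_log_norm_leadingCoeff_samplePoly_le X hn.1 hn.2 ω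
  · exact not_lt.1 hcon

theorem tendstoInMeasure_integral_empiricalRootMeasure [Nonempty ι] [IsProbabilityMeasure P]
    [∀ k, IsProbabilityMeasure (μ k)] (hX : IsSample P μ X) (hlog : ∀ k, HasLogMoment (μ k))
    (hdeg : ∀ᶠ n in atTop, (∀ k, d k n ≤ n) ∧ ∃ k, d k n = n) {c : ι → ℝ}
    (hc : ∀ k, Tendsto (fun n : ℕ => (d k n : ℝ) / n) atTop (𝓝 (c k)))
    (hnondeg : ∀ k, ¬ BddAbove (Set.range (d k)) → NonDegenerate (μ k))
    {F : Type*} [NormedAddCommGroup F] [NormedSpace ℝ F] [CompleteSpace F]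
    {φ : ℂ → F} (hφ : ContDiff ℝ 2 φ) (hφc : HasCompactSupport φ) :
    TendstoInMeasure P
      (fun n ω => ∫ w, φ w ∂(empiricalRootMeasure n (samplePoly X (fun k => d k n) ω))) atTop
      fun _ => (2 * π)⁻¹ • ∫ z, realMaxPotential c μ z • (Δ φ) z := by
  have hpointwise : ∀ᵐ z, TendstoInMeasure P
      (fun (n : ℕ) ω => (n : ℝ)⁻¹ * log ‖∑ k, polyValue X z k (d k n) ω‖) atTop
      fun _ => realMaxPotential c μ z :=
    (hX.ae_isGoodPoint hlog).mono fun z hz =>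
      hX.tendstoInMeasure_inv_mul_log_norm_sum hz hc hnondeg
  have hU (R : ℝ) := memLp_realMaxPotential (c := c) hlog R
  let f (n : ℕ) (z : ℂ) (ω : Ω) : ℝ := (n : ℝ)⁻¹ * log ‖∑ k, polyValue X z k (d k n) ω‖
  have hf_int : ∀ᶠ n in atTop, ∀ ω, LocallyIntegrable fun z => f n z ω := by
    filter_upwards [hdeg, eventually_ne_atTop 0] with n hn hn_ne ω
    simp_rw [f, ← eval_samplePoly]
    exact locallyIntegrable_of_memLp_closedBall one_le_two
      (memLp_inv_mul_log_norm_eval hn_ne (natDegree_samplePoly X hn.1 hn.2 ω))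
  have hlim : TendstoInMeasure P (fun n ω => ∫ z, f n z ω • (2 * π)⁻¹ • (Δ φ) z) atTop
      fun _ => ∫ z, realMaxPotential c μ z • (2 * π)⁻¹ • (Δ φ) z :=
    tendstoInMeasure_integral_smul_of_hasCompactSupport (f := f)
      (fun n => (Finset.measurable_fun_sum _ fun k _ =>
        hX.measurable_polyValue_uncurry k (d k n)).norm.log.const_mul (n : ℝ)⁻¹)
      measurable_realMaxPotential hpointwise
      (fun R => hX.boundedInProbability_eLpNorm_sub hlog hdeg (hU R)) hf_int
      (locallyIntegrable_of_memLp_closedBall one_le_two hU)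
      ((continuous_laplacian hφ).const_smul _) (hasCompactSupport_laplacian hφc).smul_left
  have hconst (g : ℂ → ℝ) :
      ∫ z, g z • (2 * π)⁻¹ • (Δ φ) z = (2 * π)⁻¹ • ∫ z, g z • (Δ φ) z := by
    rw [← integral_smul]
    simp_rw [smul_comm (g _)]
  simp_rw [hconst] at hlim
  refine hlim.congr' ?_ ae_eq_rfl
  filter_upwards [hdeg, eventually_ne_atTop 0] with n hn hn_ne
  refine ae_of_all _ fun ω => ?_
  simp_rw [f, ← eval_samplePoly]
  exact (integral_empiricalRootMeasure_eq_integral_laplacian hn_ne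
    (natDegree_samplePoly X hn.1 hn.2 ω) hφ hφc).symm

end IsSample

end RandomPolynomial

section WeakConvergence

open scoped ContDiff in
theorem measure_ext_of_integral_contDiff {E : Type*} [NormedAddCommGroup E] [NormedSpace ℝ E]
    [FiniteDimensional ℝ E] [MeasurableSpace E] [BorelSpace E] {ρ ρ' : Measure E}
    [IsFiniteMeasure ρ] [IsFiniteMeasure ρ']
    (h : ∀ g : E → ℝ, ContDiff ℝ ∞ g → HasCompactSupport g → ∫ x, g x ∂ρ = ∫ x, g x ∂ρ') :
    ρ = ρ' := by
  have hac : ρ ≪ ρ + ρ' := Measure.absolutelyContinuous_of_le (Measure.le_add_right le_rfl)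
  have hac' : ρ' ≪ ρ + ρ' := Measure.absolutelyContinuous_of_le (Measure.le_add_left le_rfl)
  have hreal : ∀ᵐ x ∂(ρ + ρ'),
      (ρ.rnDeriv (ρ + ρ') x).toReal = (ρ'.rnDeriv (ρ + ρ') x).toReal := by
    refine ae_eq_of_integral_contDiff_smul_eq Measure.integrable_toReal_rnDeriv.locallyIntegrable
      Measure.integrable_toReal_rnDeriv.locallyIntegrable fun g hg hgc => ?_
    simp_rw [smul_eq_mul, mul_comm (g _), ← smul_eq_mul]
    rw [integral_rnDeriv_smul hac, integral_rnDeriv_smul hac', h g hg hgc]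
  have hdensity : ρ.rnDeriv (ρ + ρ') =ᵐ[ρ + ρ'] ρ'.rnDeriv (ρ + ρ') := by
    filter_upwards [hreal, ρ.rnDeriv_lt_top (ρ + ρ'), ρ'.rnDeriv_lt_top (ρ + ρ')] with x hx h1 h2
    exact (ENNReal.toReal_eq_toReal_iff' h1.ne h2.ne).1 hx
  calc ρ = (ρ + ρ').withDensity (ρ.rnDeriv (ρ + ρ')) :=
        (Measure.withDensity_rnDeriv_eq ρ (ρ + ρ') hac).symm
    _ = (ρ + ρ').withDensity (ρ'.rnDeriv (ρ + ρ')) := withDensity_congr_ae hdensity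
    _ = ρ' := Measure.withDensity_rnDeriv_eq ρ' (ρ + ρ') hac'

open scoped ContDiff in
/-- Smooth compactly supported complex-valued functions on the plane. -/
abbrev SmoothTest : Type := {φ : ℂ → ℂ // ContDiff ℝ ∞ φ ∧ HasCompactSupport φ}

/-- The functional `φ ↦ ∫ φ dν` on smooth compactly supported functions, i.e. `ν` as a
distribution. It takes values in the product space `SmoothTest → ℂ`, whose topology is that of
convergence against each test function. -/
def testIntegral (ν : Measure ℂ) (φ : SmoothTest) : ℂ := ∫ z, φ.1 z ∂ν

theorem eq_of_testIntegral_eq {ρ ρ' : Measure ℂ} [IsFiniteMeasure ρ] [IsFiniteMeasure ρ']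
    (h : testIntegral ρ = testIntegral ρ') : ρ = ρ' := by
  refine measure_ext_of_integral_contDiff fun g hg hgc => ?_
  have hcomplex := congrFun h ⟨fun z => (g z : ℂ), Complex.ofRealCLM.contDiff.comp hg,
    hgc.comp_left Complex.ofReal_zero⟩
  simp only [testIntegral, integral_complex_ofReal] at hcomplex
  exact_mod_cast hcomplex

theorem continuous_integral_boundedContinuousFunction (g : ℂ →ᵇ ℂ) :
    Continuous fun ν : ProbabilityMeasure ℂ => ∫ z, g z ∂(ν : Measure ℂ) :=
  continuous_iff_continuousAt.2 fun _ =>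
    (ProbabilityMeasure.tendsto_iff_forall_integral_rclike_tendsto ℂ).1 tendsto_id g

theorem continuous_testIntegral :
    Continuous fun ν : ProbabilityMeasure ℂ => testIntegral (ν : Measure ℂ) := by
  refine continuous_pi fun ⟨φ, hφ, hφc⟩ => ?_
  obtain ⟨C, hC⟩ := hφc.exists_bound_of_continuous hφ.continuous
  exact continuous_integral_boundedContinuousFunction
    (.ofNormedAddCommGroup φ hφ.continuous C hC)

/-- Probability measures with logarithmic moment at most `C`. -/
def logMomentLE (C : ℝ≥0∞) : Set (ProbabilityMeasure ℂ) :=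
  {ν | logMoment (ν : Measure ℂ) ≤ C}

theorem isCompact_closure_logMomentLE {C : ℝ≥0∞} (hC : C ≠ ∞) :
    IsCompact (closure (logMomentLE C)) := by
  refine isCompact_closure_of_isTightMeasureSet ?_
  rw [isTightMeasureSet_iff_exists_isCompact_measure_compl_le]
  intro ε hε
  obtain ⟨N, hN⟩ := exists_nat_forall_measure_ge_le (α := ℂ) hC hε
  refine ⟨closedBall 0 (exp N), isCompact_closedBall _ _, ?_⟩
  rintro _ ⟨ν, hν, rfl⟩
  refine (measure_mono fun w hw => ?_).trans (hN ν
    (continuous_posLog.measurable.comp measurable_norm).enorm.aemeasurable hν)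
  have hw : exp N < ‖w‖ := by
    rwa [Set.mem_compl_iff, mem_closedBall_zero_iff, not_le] at hw
  have hlog : (N : ℝ) ≤ log⁺ ‖w‖ :=
    le_max_of_le_right ((le_log_iff_exp_le ((exp_pos _).trans hw)).2 hw.le)
  change (N : ℝ≥0∞) ≤ ‖log⁺ ‖w‖‖ₑ
  rw [Real.enorm_of_nonneg posLog_nonneg, ← ENNReal.ofReal_natCast]
  exact ENNReal.ofReal_le_ofReal hlog

variable {Ω : Type*} [MeasurableSpace Ω] {P : Measure Ω}

theorem tendsto_measure_notMem_of_tendstoInMeasure {ι E : Type*} [SeminormedAddCommGroup E]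
    {f : ℕ → Ω → ι → E} {L : ι → E}
    (h : ∀ i, TendstoInMeasure P (fun n ω => f n ω i) atTop fun _ => L i)
    {W : Set (ι → E)} (hW : W ∈ 𝓝 L) :
    Tendsto (fun n => P {ω | f n ω ∉ W}) atTop (𝓝 0) := by
  rw [nhds_pi, Filter.mem_pi] at hW
  obtain ⟨I, hI, t, ht, hsub⟩ := hW
  choose ε hε hball using fun i => Metric.mem_nhds_iff.1 (ht i)
  have hsum : Tendsto (fun n => ∑ i ∈ hI.toFinset, P {ω | ε i ≤ ‖f n ω i - L i‖}) atTop (𝓝 0) := by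
    rw [← Finset.sum_const_zero (s := hI.toFinset)]
    exact tendsto_finsetSum _ fun i _ => tendstoInMeasure_iff_norm.1 (h i) _ (hε i)
  refine tendsto_of_tendsto_of_tendsto_of_le_of_le tendsto_const_nhds hsum
    (fun _ => zero_le) fun n => ?_
  refine (measure_mono fun ω hω => ?_).trans (measure_biUnion_finset_le _ _)
  by_contra hcon
  simp only [Set.mem_iUnion, not_exists] at hcon
  exact hω (hsub fun i hi => hball i (mem_ball_iff_norm.2
    (not_le.1 (hcon i (hI.mem_toFinset.2 hi)))))

variable {ν : ℕ → Ω → Measure ℂ} {L : SmoothTest → ℂ}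

theorem exists_probabilityMeasure_testIntegral_eq [IsProbabilityMeasure P]
    (hν : ∀ᶠ n in atTop, ∀ ω, IsProbabilityMeasure (ν n ω))
    (hbdd : BoundedInProbability P fun n ω => logMoment (ν n ω))
    (hL : ∀ φ, TendstoInMeasure P (fun n ω => testIntegral (ν n ω) φ) atTop fun _ => L φ) :
    ∃ ρ : ProbabilityMeasure ℂ, testIntegral (ρ : Measure ℂ) = L := by
  obtain ⟨C, hC, hP⟩ := hbdd 2⁻¹ (by norm_num)
  -- If `L` were not represented, it would have a neighbourhood avoided by every `ν n ω` of
  -- logarithmic moment at most `C`, which is most of them.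
  by_contra hcon
  let K := (fun κ : ProbabilityMeasure ℂ => testIntegral (κ : Measure ℂ)) '' closure (logMomentLE C)
  have hK : IsClosed K :=
    ((isCompact_closure_logMomentLE hC).image continuous_testIntegral).isClosed
  have hW : Kᶜ ∈ 𝓝 L := hK.isOpen_compl.mem_nhds fun ⟨ρ, _, hρ⟩ => hcon ⟨ρ, hρ⟩
  have hsmall := (tendsto_measure_notMem_of_tendstoInMeasure hL hW).eventually_lt_const
    (show (0 : ℝ≥0∞) < 2⁻¹ by norm_num)
  obtain ⟨n, hn, hlarge, hnear⟩ := (hν.and (hP.and hsmall)).exists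
  have hcover : Set.univ ⊆ {ω | C < logMoment (ν n ω)} ∪ {ω | testIntegral (ν n ω) ∉ Kᶜ} := by
    intro ω _
    by_cases hω : C < logMoment (ν n ω)
    · exact .inl hω
    · exact .inr fun h => h ⟨⟨ν n ω, hn ω⟩, subset_closure (not_lt.1 hω), rfl⟩
  have : (1 : ℝ≥0∞) < 1 := calc
    1 = P Set.univ := measure_univ.symm
    _ ≤ P {ω | C < logMoment (ν n ω)} + P {ω | testIntegral (ν n ω) ∉ Kᶜ} :=
      (measure_mono hcover).trans (measure_union_le _ _)
    _ < 2⁻¹ + 2⁻¹ := ENNReal.add_lt_add_of_le_of_lt (by finiteness) hlarge hnear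
    _ = 1 := ENNReal.inv_two_add_inv_two
  exact this.false

theorem tendstoWeaklyInProbability_of_testIntegral {ρ : Measure ℂ} [IsProbabilityMeasure ρ]
    (hν : ∀ᶠ n in atTop, ∀ ω, IsProbabilityMeasure (ν n ω))
    (hbdd : BoundedInProbability P fun n ω => logMoment (ν n ω))
    (hρ : ∀ φ, TendstoInMeasure P (fun n ω => testIntegral (ν n ω) φ) atTop
      fun _ => testIntegral ρ φ) :
    TendstoWeaklyInProbability P ν ρ := by
  intro g
  rw [tendstoInMeasure_iff_norm]
  intro ε hε
  rw [ENNReal.tendsto_nhds_zero]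
  intro η hη
  obtain ⟨C, hC, hP⟩ := hbdd (η / 2) (ENNReal.half_pos hη.ne')
  -- The measures of bounded logarithmic moment that are far from `ρ` against `g` are, by
  -- compactness, bounded away from `ρ` as distributions.
  let B := closure (logMomentLE C) ∩
    {κ : ProbabilityMeasure ℂ | ε ≤ ‖∫ z, g z ∂(κ : Measure ℂ) - ∫ z, g z ∂ρ‖}
  have hB : IsCompact B := (isCompact_closure_logMomentLE hC).inter_right (isClosed_le
    continuous_const ((continuous_integral_boundedContinuousFunction g).sub continuous_const).norm)
  let K := (fun κ : ProbabilityMeasure ℂ => testIntegral (κ : Measure ℂ)) '' B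
  have hW : Kᶜ ∈ 𝓝 (testIntegral ρ) := by
    refine (hB.image continuous_testIntegral).isClosed.isOpen_compl.mem_nhds ?_
    rintro ⟨κ, ⟨-, hκ⟩, hκρ⟩
    have hκ : ε ≤ ‖∫ z, g z ∂(κ : Measure ℂ) - ∫ z, g z ∂ρ‖ := hκ
    rw [eq_of_testIntegral_eq hκρ, sub_self, norm_zero] at hκ
    exact hκ.not_gt hε
  filter_upwards [hν, hP, ENNReal.tendsto_nhds_zero.1
    (tendsto_measure_notMem_of_tendstoInMeasure hρ hW) _ (ENNReal.half_pos hη.ne')]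
    with n hn hlarge hnear
  calc P {ω | ε ≤ ‖∫ z, g z ∂ν n ω - ∫ z, g z ∂ρ‖}
      ≤ P ({ω | C < logMoment (ν n ω)} ∪ {ω | testIntegral (ν n ω) ∉ Kᶜ}) := by
        refine measure_mono fun ω hω => ?_
        by_cases hmoment : C < logMoment (ν n ω)
        · exact .inl hmoment
        · exact .inr fun h => h ⟨⟨ν n ω, hn ω⟩, ⟨subset_closure (not_lt.1 hmoment), hω⟩, rfl⟩
    _ ≤ η / 2 + η / 2 := (measure_union_le _ _).trans (add_le_add hlarge hnear)
    _ = η := ENNReal.add_halves η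

end WeakConvergence

section LimitMeasure

/-- The distribution `(1/2π) Δ u` on smooth compactly supported test functions. -/
def distribLaplacian (u : ℂ → ℝ) (φ : SmoothTest) : ℂ :=
  (2 * π)⁻¹ • ∫ z, u z • (Δ φ.1) z

theorem isDistribLaplacian_iff {ρ : Measure ℂ} {U : ℂ → EReal} {u : ℂ → ℝ}
    (hU : ∀ᵐ z, U z = u z) : IsDistribLaplacian ρ U ↔ testIntegral ρ = distribLaplacian u := by
  have htoReal (φ : ℂ → ℂ) : ∫ z, (U z).toReal • (Δ φ) z = ∫ z, u z • (Δ φ) z := by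
    refine integral_congr_ae ?_
    filter_upwards [hU] with z hz
    rw [hz, EReal.toReal_coe]
  simp_rw [IsDistribLaplacian, htoReal]
  exact ⟨fun h => funext fun φ => h φ.1 φ.2.1 φ.2.2,
    fun h φ hφ hφc => congrFun h ⟨φ, hφ, hφc⟩⟩

theorem IsSample.exists_tendstoWeaklyInProbability {ι Ω : Type*} [Fintype ι] [Nonempty ι]
    [MeasurableSpace Ω] {P : Measure Ω} [IsProbabilityMeasure P] {μ : ι → Measure ℂ}
    [∀ k, IsProbabilityMeasure (μ k)] {X : ℕ → ι → Ω → ℂ} (hX : IsSample P μ X)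
    (hlog : ∀ k, HasLogMoment (μ k)) {d : ι → ℕ → ℕ}
    (hdeg : ∀ᶠ n in atTop, (∀ k, d k n ≤ n) ∧ ∃ k, d k n = n) {c : ι → ℝ}
    (hc : ∀ k, Tendsto (fun n : ℕ => (d k n : ℝ) / n) atTop (𝓝 (c k)))
    (hnondeg : ∀ k, ¬ BddAbove (Set.range (d k)) → NonDegenerate (μ k)) :
    ∃ ρ : ProbabilityMeasure ℂ,
      TendstoWeaklyInProbability P
        (fun n ω => empiricalRootMeasure n (samplePoly X (fun k => d k n) ω)) ρ ∧
      testIntegral (ρ : Measure ℂ) = distribLaplacian (realMaxPotential c μ) := by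
  have hprob : ∀ᶠ n in atTop, ∀ ω,
      IsProbabilityMeasure (empiricalRootMeasure n (samplePoly X (fun k => d k n) ω)) := by
    filter_upwards [hdeg, eventually_ne_atTop 0] with n hn hn_ne ω
    exact isProbabilityMeasure_empiricalRootMeasure hn_ne (natDegree_samplePoly X hn.1 hn.2 ω)
  have hbdd := hX.boundedInProbability_logMoment hlog hdeg
  have hlim (φ : SmoothTest) : TendstoInMeasure P
      (fun n ω => testIntegral (empiricalRootMeasure n (samplePoly X (fun k => d k n) ω)) φ) atTop
      fun _ => distribLaplacian (realMaxPotential c μ) φ :=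
    hX.tendstoInMeasure_integral_empiricalRootMeasure hlog hdeg hc hnondeg
      (contDiff_infty.1 φ.2.1 2) φ.2.2
  obtain ⟨ρ, hρ⟩ := exists_probabilityMeasure_testIntegral_eq hprob hbdd hlim
  exact ⟨ρ, tendstoWeaklyInProbability_of_testIntegral hprob hbdd fun φ => hρ ▸ hlim φ, hρ⟩

end LimitMeasure

end RandomPolySum

end

theorem theorem1p2 {Ω : Type*} [MeasurableSpace Ω] (P : Measure Ω) [IsProbabilityMeasure P]
    (m : ℕ) (hm : 2 ≤ m)
    (μ : Fin m → Measure ℂ) (hμ : ∀ k, IsProbabilityMeasure (μ k))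
    (hlog : ∀ k, RandomPolySum.HasLogMoment (μ k))
    (X : ℕ → Fin m → Ω → ℂ) (hX : ∀ i k, Measurable (X i k))
    (hindep : iIndepFun (fun ik : ℕ × Fin m => X ik.1 ik.2) P)
    (hlaw : ∀ i k, P.map (X i k) = μ k)
    (d : Fin m → ℕ → ℕ)
    (hd_first : ∀ n, 1 ≤ n → d ⟨0, by omega⟩ n = n)
    (hd_le : ∀ k n, 1 ≤ n → d k n ≤ n)
    (c : Fin m → ℝ) (hc_mem : ∀ k, c k ∈ Set.Icc (0 : ℝ) 1)
    (hc : ∀ k, Tendsto (fun n : ℕ => (d k n : ℝ) / (n : ℝ)) atTop (𝓝 (c k)))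
    (hnondeg : ∀ k, ¬ BddAbove (Set.range (d k)) → RandomPolySum.NonDegenerate (μ k)) :
    (∀ᵐ z : ℂ ∂volume, RandomPolySum.maxPotential c μ z ≠ ⊥ ∧ RandomPolySum.maxPotential c μ z ≠ ⊤) ∧
    LocallyIntegrable (fun z : ℂ => (RandomPolySum.maxPotential c μ z).toReal) volume ∧
    ∃ ρ : Measure ℂ, IsProbabilityMeasure ρ ∧
      RandomPolySum.TendstoWeaklyInProbability P
        (fun n ω => RandomPolySum.empiricalRootMeasure n
          (∑ k, RandomPolySum.rootPoly (fun i => X i k ω) (d k n))) ρ ∧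
      RandomPolySum.IsDistribLaplacian ρ (RandomPolySum.maxPotential c μ) ∧
      ∀ ρ' : Measure ℂ, IsProbabilityMeasure ρ' →
        RandomPolySum.IsDistribLaplacian ρ' (RandomPolySum.maxPotential c μ) → ρ' = ρ := by
  have : Nonempty (Fin m) := ⟨⟨0, by omega⟩⟩
  have hdeg : ∀ᶠ n in atTop, (∀ k, d k n ≤ n) ∧ ∃ k, d k n = n :=
    (eventually_ge_atTop 1).mono fun n hn => ⟨fun k => hd_le k n hn, _, hd_first n hn⟩
  have hsample : RandomPolySum.IsSample P μ X := ⟨hX, hindep, hlaw⟩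
  obtain ⟨ρ, hweak, hρ⟩ := hsample.exists_tendstoWeaklyInProbability hlog hdeg hc hnondeg
  have hiff (ρ' : Measure ℂ) := RandomPolySum.isDistribLaplacian_iff (ρ := ρ')
    (RandomPolySum.ae_maxPotential_eq_realMaxPotential (c := c) hlog)
  exact ⟨RandomPolySum.ae_maxPotential_ne_bot_and_ne_top hlog,
    RandomPolySum.locallyIntegrable_toReal_maxPotential hlog,
    ρ, inferInstance, hweak, (hiff ρ).2 hρ, fun ρ' _ hρ' =>
      RandomPolySum.eq_of_testIntegral_eq (((hiff ρ').1 hρ').trans hρ.symm)⟩
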